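/- **Setting.** Let $k$ be a field. A *regular triangular algebra* (RTA) is an associative unital $k$-algebra $A$ with the following data. For a commutative $k$-algebra $R$ and an algebra map $\lambda:R\to k$ (a weight), the $\lambda$-weight space of an $R$-module $M$ is $M_\lambda=\{m: rm=\lambda(r)m\ \forall r\in R\}$. 1. Unital subalgebras $B_-,H,B_+$ such that multiplication $B_-\otimes H\otimes B_+\to A$ is a linear isomorphism; the images $B_-\otimes H$ and $H\otimes B_+$ are subalgebras. 2. An algebra map $\mathrm{ad}:H\to\mathrm{End}_k(A)$ such that every $\mathrm{ad}\,h$ preserves $H$, $B_+$ and $B_-$. 3. A group $\mathcal P$ acting freely (written $*$) on the set of weights $G=\mathrm{Hom}_{k\text{-alg}}(H,k)$, and $0_G\in G$ such that $\mathrm{ad}\,h$ acts on $H$ as the scalar $0_G(h)$. For $\theta\in\mathcal P$ write $A_\theta$ for the $(\theta*0_G)$-weight space of $(A,\mathrm{ad})$, and $(B_\pm)_\theta=B_\pm\cap A_\theta$. 4. A subalgebra $H_0\subset H$ and a free abelian group $\mathcal P_0$ of finite rank with $\mathbb Z$-basis $\Delta$, acting freely on $G_0=\mathrm{Hom}_{k\text{-alg}}(H_0,k)$,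 such that the restriction map $\pi:G\to G_0$ induces a surjection $\pi:\mathcal P\to\mathcal P_0$ with $\pi(\theta*\lambda)=\pi(\theta)*\pi(\lambda)$. 5. $B_\pm=\bigoplus(B_\pm)_\theta$, the sum over $\theta\in\mathcal P$ with $\pi(\theta)\in\pm\mathbb Z_{\ge0}\Delta$. For $\theta_0\in\mathcal P_0$ put $(B_\pm)_{\theta_0}=\bigoplus_{\pi(\mu)=\theta_0*\pi(0_G)}(B_\pm\cap A_\mu)$; then $(B_\pm)_0=k$ and $\dim_k(B_\pm)_{\theta_0}<\infty$ for $\theta_0\in\pm\mathbb Z_{\ge0}\Delta$. 6. $A_\theta A_{\theta'}\subset A_{\theta\theta'}$ and $A_\theta M_\lambda\subset M_{\theta*\lambda}$ for all $\theta,\theta'\in\mathcal P$, $\lambda\in G$ and all $A$-modules $M$. 7. An anti-involution $i$ of the $k$-algebra $A$ that fixes $H$ pointwise and maps $A_\theta$ into $A_{\theta^{-1}}$. Put $N_\pm=\bigoplus_{\pi(\theta)\ne0}(B_\pm)_\theta$, let $\epsilon^\pm:B_\pm\to k$ be the linear map with $\epsilon^\pm(1)=1$ and $\epsilon^\pm(N_\pm)=0$,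 and let $\xi=\epsilon^-\otimes\mathrm{id}\otimes\epsilon^+:A\to H$. Let $\Gamma$ be a finite group acting on an RTA $A$ by $k$-algebra automorphisms, with $\mathrm{char}\,k=0$ if $|\Gamma|>1$, such that $\Gamma$ preserves $H,H_0,N_\pm$, commutes with $i$, and $\gamma(\mathrm{ad}\,h(a))=\mathrm{ad}\,\gamma(h)(\gamma(a))$. Let $\Gamma$ act on $G$ and $G_0$ by $(\gamma\lambda)(h)=\lambda(\gamma^{-1}h)$. Assume that $\Gamma$ preserves $\mathcal P*0_G$ with $\gamma(\theta*\lambda)=\gamma(\theta)*\gamma(\lambda)$ (where $\gamma(\theta)*0_G=\gamma(\theta*0_G)$), and that $\Gamma$ preserves the partial order on $G_0$ given by $\mu\le\mu'$ iff $\mu'\in(\mathbb Z_{\ge0}\Delta)*\mu$. Let $A\rtimes\Gamma$ be the skew group ring and $Z$ its center. Let $X$ be the set of isomorphism classes of simple finite-dimensional $H$-semisimple (i.e. a direct sum of $H$-weight spaces) $H\rtimes\Gamma$-modules. For $x\in X$, represented by $M_x$, let $\lambda_x\subset G$ be its set of weights (a $\Gamma$-orbit), and let $Z(x)=(A\rtimes\Gamma)\otimes_{(H\otimes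 B_+)\rtimes\Gamma}M_x$ be the Verma module, where $N_+$ acts on $M_x$ by $0$. For $\lambda\in G$ define $\chi_\lambda:A\rtimes\Gamma\to k\Gamma$ by $\chi_\lambda(\sum_\gamma a_\gamma\gamma)=\sum_{\gamma:\gamma\lambda=\lambda}\lambda(\xi(a_\gamma))\gamma$. Let $\mathcal O$ be the category of finitely generated $H$-semisimple $A\rtimes\Gamma$-modules $M$ with finite-dimensional weight spaces and $\dim B_+m<\infty$ for all $m\in M$. **Theorem.** 1. Suppose that $k$ is algebraically closed if $|\Gamma|>1$. Then for every $x\in X$ there is a unique $k$-algebra map $\chi_x:Z\to k$ through which $Z$ acts on $Z(x)$. Moreover, for every $\lambda\in\lambda_x$ and $\gamma\in\Gamma$, $\chi_x=\chi_\lambda=\chi_{\gamma(\lambda)}$ on $Z\cap A$ (with $k\subset k\Gamma$). 2. Suppose that ($k$ being arbitrary again) $Z$ acts on every $Z(x)$, $x\in X$, via some algebra map $\theta_x:Z\to k$, and let $\Theta=\{\theta_x:x\in X\}$. Then $\mathcal O=\bigoplus_{\nu\in\Theta}\mathcal O(\nu)$, where $\mathcal O(\nu)$ is the full subcategory of all $M\in\mathcal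 O$ such that for all $m\in M$, $z\in Z$ there is $n\in\mathbb N$ with $(z-\nu(z))^nm=0$. That is, every $M\in\mathcal O$ is a direct sum of submodules $M_\nu\in\mathcal O(\nu)$ $(\nu\in\Theta)$, only finitely many of them nonzero, and there are no nonzero homomorphisms between objects of $\mathcal O(\nu)$ and $\mathcal O(\nu')$ for distinct $\nu,\nu'\in\Theta$. -/

import Mathlib

open scoped TensorProduct

universe u

noncomputable section

/-! ### Weight spaces -/

/-- The `μ`-weight space of a representation `ρ` of a `k`-algebra `H` on `M`, where `μ` is a weight
(an algebra map `H → k`): all `m` with `h m = μ(h) m` for every `h`. -/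
def wtSpace {k H M : Type*} [Field k] [Ring H] [Algebra k H] [AddCommGroup M] [Module k M]
    (ρ : H →ₐ[k] Module.End k M) (μ : H →ₐ[k] k) : Submodule k M where
  carrier := {m | ∀ h, ρ h m = μ h • m}
  zero_mem' := by intro h; simp
  add_mem' := by intro a b ha hb h; rw [map_add, ha h, hb h, smul_add]
  smul_mem' := by intro c a ha h; rw [map_smul, ha h, smul_comm]

theorem mem_wtSpace {k H M : Type*} [Field k] [Ring H] [Algebra k H] [AddCommGroup M] [Module k M]
    (ρ : H →ₐ[k] Module.End k M) (μ : H →ₐ[k] k) (m : M) :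
    m ∈ wtSpace ρ μ ↔ ∀ h, ρ h m = μ h • m := Iff.rfl

/-- Weight spaces of a commutative algebra for distinct weights are independent. In particular, a
supremum of weight spaces for distinct weights is automatically a direct sum. -/
theorem iSupIndep_wtSpace {k H M : Type*} [Field k] [Ring H] [Algebra k H] [AddCommGroup M]
    [Module k M] (ρ : H →ₐ[k] Module.End k M) (hcomm : ∀ a b : H, a * b = b * a) :
    iSupIndep (wtSpace ρ) := by
  have hc : ∀ i j : H, Commute (ρ j) (ρ i) := fun i j => by
    have h := congrArg ρ (hcomm j i)
    rwa [map_mul, map_mul] at h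
  have key := Module.End.independent_iInf_maxGenEigenspace_of_forall_mapsTo
    (fun h : H => ρ h) (fun i j φ => Module.End.mapsTo_maxGenEigenspace_of_comm (hc i j) φ)
  have inj : Function.Injective (fun (μ : H →ₐ[k] k) (h : H) => μ h) := by
    intro a b hab
    ext h
    exact congrFun hab h
  refine (key.comp inj).mono fun μ m hm => ?_
  simp only [Function.comp, Submodule.mem_iInf]
  intro h
  rw [Module.End.mem_maxGenEigenspace]
  exact ⟨1, by simpa [sub_eq_zero] using hm h⟩

/-- The multiplication map `B₁ ⊗ B₂ ⊗ B₃ → A` for three subalgebras. -/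
def mulMap3 {k A : Type*} [Field k] [Ring A] [Algebra k A] (B₁ B₂ B₃ : Subalgebra k A) :
    ((B₁ ⊗[k] B₂) ⊗[k] B₃) →ₗ[k] A :=
  LinearMap.mul' k A ∘ₗ TensorProduct.map
    (LinearMap.mul' k A ∘ₗ TensorProduct.map B₁.val.toLinearMap B₂.val.toLinearMap)
    B₃.val.toLinearMap

/-! ### Regular triangular algebras -/

/-- The data of a regular triangular algebra. The set of weights is `G = (H →ₐ[k] k)`, the set of
restricted weights is `G₀ = (H₀ →ₐ[k] k)`; the groups `P` and `P₀` act on them. -/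
structure RTAData (k A : Type u) [Field k] [Ring A] [Algebra k A] where
  /-- the subalgebra `B₋` -/
  Bm : Subalgebra k A
  /-- the Cartan part -/
  H : Subalgebra k A
  /-- the subalgebra `B₊` -/
  Bp : Subalgebra k A
  /-- the adjoint action of `H` on `A` -/
  ad : H →ₐ[k] Module.End k A
  /-- the group acting on the weights -/
  P : Type u
  [groupP : Group P]
  [actP : MulAction P (H →ₐ[k] k)]
  /-- the distinguished weight `0_G` -/
  zeroG : H →ₐ[k] k
  /-- the smaller Cartan part -/
  H0 : Subalgebra k A
  H0_le : H0 ≤ H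
  /-- the root lattice -/
  P0 : Type u
  [groupP0 : AddCommGroup P0]
  [actP0 : AddAction P0 (H0 →ₐ[k] k)]
  /-- the map `P → P₀` induced by restriction of weights -/
  piP : P → P0
  /-- the number of simple roots -/
  rk : ℕ
  /-- the simple roots, a finite `ℤ`-basis of `P₀` -/
  Δ : Module.Basis (Fin rk) ℤ P0
  /-- the anti-involution -/
  inv : A →ₗ[k] A

attribute [instance] RTAData.groupP RTAData.actP RTAData.groupP0 RTAData.actP0

namespace RTAData

variable {k A : Type u} [Field k] [Ring A] [Algebra k A] (D : RTAData k A)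

/-- Restriction of weights `π : G → G₀`. -/
def res (μ : D.H →ₐ[k] k) : D.H0 →ₐ[k] k := μ.comp (Subalgebra.inclusion D.H0_le)

/-- The cone `ℤ≥0 Δ` in the root lattice. -/
def cone : AddSubmonoid D.P0 := AddSubmonoid.closure (Set.range D.Δ)

/-- For a subspace `S` of `A`, the weight space `S_μ` for the adjoint action. -/
def adWt (S : Submodule k A) (μ : D.H →ₐ[k] k) : Submodule k A := S ⊓ wtSpace D.ad μ

/-- For a subspace `S` of `A` and `θ₀` in the root lattice, the restricted weight space
`S_{θ₀} = ⨁_{π(μ) = θ₀ * π(0_G)} S_μ`. -/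
def adWtRes (S : Submodule k A) (θ₀ : D.P0) : Submodule k A :=
  ⨆ (μ : D.H →ₐ[k] k) (_ : D.res μ = θ₀ +ᵥ D.res D.zeroG), D.adWt S μ

/-- The augmentation ideal `⨁_{π(θ) ≠ 0} B_θ` of `B = B₊` or `B = B₋`. -/
def aug (B : Subalgebra k A) : Submodule k A :=
  ⨆ (θ : D.P) (_ : D.piP θ ≠ 0), D.adWt B.toSubmodule (θ • D.zeroG)

/-- The order on restricted weights: `μ ≤ μ'` iff `θ₀ * μ = μ'` for some `θ₀ ∈ ℤ≥0 Δ`. -/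
def le0 (μ μ' : D.H0 →ₐ[k] k) : Prop := ∃ θ₀ ∈ D.cone, θ₀ +ᵥ μ = μ'

end RTAData

/-- A regular triangular algebra over `k`. -/
structure RTA (k A : Type u) [Field k] [Ring A] [Algebra k A] extends RTAData k A where
  -- triangular decomposition
  triangular : Function.Bijective (mulMap3 Bm H Bp)
  -- `ad` preserves `H` and `B±`; the subspaces `H ⊗ B₊` and `B₋ ⊗ H` are subalgebras
  ad_H : ∀ (h : H), ∀ a ∈ H, ad h a ∈ H
  ad_Bp : ∀ (h : H), ∀ a ∈ Bp, ad h a ∈ Bp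
  ad_Bm : ∀ (h : H), ∀ a ∈ Bm, ad h a ∈ Bm
  mul_HBp : ∀ x ∈ Subalgebra.toSubmodule H * Subalgebra.toSubmodule Bp,
    ∀ y ∈ Subalgebra.toSubmodule H * Subalgebra.toSubmodule Bp,
      x * y ∈ Subalgebra.toSubmodule H * Subalgebra.toSubmodule Bp
  mul_BmH : ∀ x ∈ Subalgebra.toSubmodule Bm * Subalgebra.toSubmodule H,
    ∀ y ∈ Subalgebra.toSubmodule Bm * Subalgebra.toSubmodule H,
      x * y ∈ Subalgebra.toSubmodule Bm * Subalgebra.toSubmodule H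
  -- the action of `P` on `G` is free, and `H = H_{0_G}` for the adjoint action
  free_P : ∀ (θ : P) (μ : H →ₐ[k] k), θ • μ = μ → θ = 1
  ad_zeroG : ∀ h : H, ∀ a ∈ H, ad h a = zeroG h • a
  -- the action of `P₀` on `G₀` is free; restriction maps `P * 0_G` onto `P₀ * π(0_G)`, and
  -- intertwines the actions
  free_P0 : ∀ (θ₀ : P0) (μ : H0 →ₐ[k] k), θ₀ +ᵥ μ = μ → θ₀ = 0
  piP_surjective : Function.Surjective piP
  res_smul : ∀ (θ : P) (μ : H →ₐ[k] k),
    toRTAData.res (θ • μ) = piP θ +ᵥ toRTAData.res μ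
  -- `B±` are sums of weight spaces with weights in `± ℤ≥0 Δ`
  Bp_decomp : Subalgebra.toSubmodule Bp =
    ⨆ (θ : P) (_ : piP θ ∈ toRTAData.cone),
      toRTAData.adWt (Subalgebra.toSubmodule Bp) (θ • zeroG)
  Bm_decomp : Subalgebra.toSubmodule Bm =
    ⨆ (θ : P) (_ : -piP θ ∈ toRTAData.cone),
      toRTAData.adWt (Subalgebra.toSubmodule Bm) (θ • zeroG)
  -- regularity
  Bp_zero : toRTAData.adWtRes (Subalgebra.toSubmodule Bp) 0 = Submodule.span k {1}
  Bm_zero : toRTAData.adWtRes (Subalgebra.toSubmodule Bm) 0 = Submodule.span k {1}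
  Bp_finite : ∀ θ₀ ∈ toRTAData.cone,
    FiniteDimensional k (toRTAData.adWtRes (Subalgebra.toSubmodule Bp) θ₀)
  Bm_finite : ∀ θ₀ ∈ toRTAData.cone,
    FiniteDimensional k (toRTAData.adWtRes (Subalgebra.toSubmodule Bm) (-θ₀))
  -- the property of weights
  weights_mul : ∀ (θ θ' : P), ∀ a ∈ wtSpace ad (θ • zeroG), ∀ b ∈ wtSpace ad (θ' • zeroG),
    a * b ∈ wtSpace ad ((θ * θ') • zeroG)
  weights_smul : ∀ (M : Type u) [AddCommGroup M] [Module k M] [Module A M] [IsScalarTower k A M]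
    (θ : P) (μ : H →ₐ[k] k), ∀ a ∈ wtSpace ad (θ • zeroG),
    ∀ m ∈ wtSpace ((Algebra.lsmul k k M).comp H.val) μ,
      a • m ∈ wtSpace ((Algebra.lsmul k k M).comp H.val) (θ • μ)
  -- the anti-involution
  inv_inv : ∀ a, inv (inv a) = a
  inv_mul : ∀ a b, inv (a * b) = inv b * inv a
  inv_H : ∀ a ∈ H, inv a = a
  inv_wt : ∀ (θ : P), ∀ a ∈ wtSpace ad (θ • zeroG), inv a ∈ wtSpace ad (θ⁻¹ • zeroG)

namespace RTA

variable {k A : Type u} [Field k] [Ring A] [Algebra k A] (D : RTA k A)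

theorem H_comm (a b : D.H) : a * b = b * a := by
  apply Subtype.ext
  have h := D.inv_mul a b
  rw [D.inv_H _ a.2, D.inv_H _ b.2, D.inv_H _ (D.H.mul_mem a.2 b.2)] at h
  exact h

theorem piP_one : D.piP 1 = 0 := by
  apply D.free_P0 _ (D.res D.zeroG)
  rw [← D.res_smul, one_smul]

theorem one_notMem_aug (B : Subalgebra k A) : (1 : A) ∉ D.aug B := by
  intro h1
  have hind := iSupIndep_wtSpace D.ad D.H_comm
  have h0 : (1 : A) ∈ wtSpace D.ad D.zeroG := fun h => D.ad_zeroG h 1 D.H.one_mem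
  have hle : D.aug B ≤ ⨆ (μ : D.H →ₐ[k] k) (_ : μ ≠ D.zeroG), wtSpace D.ad μ := by
    refine iSup₂_le fun θ hθ => ?_
    refine le_trans inf_le_right (le_iSup₂_of_le (θ • D.zeroG) ?_ le_rfl)
    intro he
    exact hθ (by rw [D.free_P θ _ he, D.piP_one])
  have h10 : (1 : A) = 0 := Submodule.disjoint_def.1 (hind D.zeroG) 1 h0 (hle h1)
  have : (1 : D.H) = 0 := Subtype.ext h10
  have h2 := congrArg D.zeroG this
  rw [map_one, map_zero] at h2
  exact one_ne_zero h2

theorem le_span_sup_aug (B : Subalgebra k A) (S : Set D.P)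
    (hd : Subalgebra.toSubmodule B =
      ⨆ (θ : D.P) (_ : θ ∈ S), D.adWt (Subalgebra.toSubmodule B) (θ • D.zeroG))
    (hz : D.adWtRes (Subalgebra.toSubmodule B) 0 = Submodule.span k {1}) :
    Subalgebra.toSubmodule B ≤ Submodule.span k {1} ⊔ D.aug B := by
  conv_lhs => rw [hd]
  refine iSup₂_le fun θ _ => ?_
  by_cases h : D.piP θ = 0
  · refine le_trans ?_ le_sup_left
    rw [← hz]
    refine le_iSup₂_of_le (θ • D.zeroG) ?_ le_rfl
    rw [D.res_smul, h]
  · exact le_trans (le_iSup₂_of_le (f := fun (θ : D.P) (_ : D.piP θ ≠ 0) =>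
      D.adWt (Subalgebra.toSubmodule B) (θ • D.zeroG)) θ h le_rfl) le_sup_right

theorem existsUnique_aug (B : Subalgebra k A)
    (hB : Subalgebra.toSubmodule B ≤ Submodule.span k {1} ⊔ D.aug B) :
    ∃! ε : B →ₗ[k] k, ε 1 = 1 ∧ ∀ b : B, (b : A) ∈ D.aug B → ε b = 0 := by
  obtain ⟨f, hf1, hf⟩ := Submodule.exists_le_ker_of_notMem (D.one_notMem_aug B)
  refine ⟨((f 1)⁻¹ • f) ∘ₗ B.val.toLinearMap, ⟨?_, ?_⟩, ?_⟩
  · change (f 1)⁻¹ * f 1 = 1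
    exact inv_mul_cancel₀ hf1
  · intro b hb
    have : f b = 0 := hf hb
    change (f 1)⁻¹ * f b = 0
    rw [this, mul_zero]
  · rintro ε ⟨h1, h0⟩
    ext b
    obtain ⟨x, hx, n, hn, hxn⟩ := Submodule.mem_sup.1 (hB b.2)
    obtain ⟨c, rfl⟩ := Submodule.mem_span_singleton.1 hx
    have hnB : n ∈ B := by
      have : n = b - c • 1 := by rw [← hxn]; abel
      rw [this]
      exact B.sub_mem b.2 (B.smul_mem B.one_mem c)
    have hb : b = c • (1 : B) + ⟨n, hnB⟩ := Subtype.ext hxn.symm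
    have hfn : f n = 0 := hf hn
    have e1 : ε b = c := by
      rw [hb, map_add, map_smul, h1, h0 ⟨n, hnB⟩ hn, add_zero, smul_eq_mul, mul_one]
    have e2 : f b = c * f 1 := by
      rw [← hxn, map_add, map_smul, hfn, add_zero, smul_eq_mul]
    change ε b = (f 1)⁻¹ * f b
    rw [e1, e2, mul_comm c, inv_mul_cancel_left₀ hf1]

/-- The augmentation `ε⁺ : B₊ → k`, the linear map with kernel `N₊` and `ε⁺(1) = 1`. -/
def epsP : D.Bp →ₗ[k] k :=
  (D.existsUnique_aug D.Bp (D.le_span_sup_aug _ {θ | D.piP θ ∈ D.cone} D.Bp_decomp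
    D.Bp_zero)).choose

/-- The augmentation `ε⁻ : B₋ → k`, the linear map with kernel `N₋` and `ε⁻(1) = 1`. -/
def epsM : D.Bm →ₗ[k] k :=
  (D.existsUnique_aug D.Bm (D.le_span_sup_aug _ {θ | -D.piP θ ∈ D.cone} D.Bm_decomp
    D.Bm_zero)).choose

theorem epsP_spec : D.epsP 1 = 1 ∧ ∀ b : D.Bp, (b : A) ∈ D.aug D.Bp → D.epsP b = 0 :=
  (D.existsUnique_aug D.Bp (D.le_span_sup_aug _ {θ | D.piP θ ∈ D.cone} D.Bp_decomp
    D.Bp_zero)).choose_spec.1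

theorem epsM_spec : D.epsM 1 = 1 ∧ ∀ b : D.Bm, (b : A) ∈ D.aug D.Bm → D.epsM b = 0 :=
  (D.existsUnique_aug D.Bm (D.le_span_sup_aug _ {θ | -D.piP θ ∈ D.cone} D.Bm_decomp
    D.Bm_zero)).choose_spec.1

/-- The triangular decomposition as a linear isomorphism. -/
def triEquiv : ((D.Bm ⊗[k] D.H) ⊗[k] D.Bp) ≃ₗ[k] A :=
  LinearEquiv.ofBijective (mulMap3 D.Bm D.H D.Bp) D.triangular

/-- The Harish-Chandra projection `ξ = ε⁻ ⊗ id ⊗ ε⁺ : A = B₋ ⊗ H ⊗ B₊ → H`. -/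
def hc : A →ₗ[k] D.H :=
  (TensorProduct.rid k D.H).toLinearMap ∘ₗ
    TensorProduct.map ((TensorProduct.lid k D.H).toLinearMap ∘ₗ
      TensorProduct.map D.epsM LinearMap.id) D.epsP ∘ₗ D.triEquiv.symm.toLinearMap

end RTA

/-! ### Skew group rings -/

/-- The automorphism of a `Γ`-stable subalgebra `B` given by `γ`. -/
def stableHom {k A Γ : Type*} [Field k] [Ring A] [Algebra k A] [Group Γ] [MulSemiringAction Γ A]
    [SMulCommClass Γ k A] (B : Subalgebra k A) (hB : ∀ γ : Γ, ∀ b ∈ B, γ • b ∈ B) (γ : Γ) :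
    B →ₐ[k] B :=
  ((MulSemiringAction.toAlgHom k A γ).comp B.val).codRestrict B fun b => hB γ b b.2

/-- The action of `Γ` on the weights of a `Γ`-stable subalgebra: `(γ μ)(b) = μ(γ⁻¹ b)`. -/
def wtAct {k A Γ : Type*} [Field k] [Ring A] [Algebra k A] [Group Γ] [MulSemiringAction Γ A]
    [SMulCommClass Γ k A] (B : Subalgebra k A) (hB : ∀ γ : Γ, ∀ b ∈ B, γ • b ∈ B) (γ : Γ)
    (μ : B →ₐ[k] k) : B →ₐ[k] k :=
  μ.comp (stableHom B hB γ⁻¹)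

/-- A regular triangular algebra `A` together with a compatible order-preserving action of `Γ`
by `k`-algebra automorphisms. -/
structure SkewRTA (k A Γ : Type u) [Field k] [Ring A] [Algebra k A] [Group Γ]
    [MulSemiringAction Γ A] [SMulCommClass Γ k A] extends RTA k A where
  -- `H`, `H₀`, `N±` are stable under `Γ` (they are stable under `ad H` in any RTA)
  smul_H : ∀ γ : Γ, ∀ a ∈ H, γ • a ∈ H
  smul_H0 : ∀ γ : Γ, ∀ a ∈ H0, γ • a ∈ H0
  smul_Np : ∀ γ : Γ, ∀ a ∈ toRTAData.aug Bp, γ • a ∈ toRTAData.aug Bp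
  smul_Nm : ∀ γ : Γ, ∀ a ∈ toRTAData.aug Bm, γ • a ∈ toRTAData.aug Bm
  -- `ad` and the action of `Γ` fit together to an action of `H ⋊ Γ` on `A`
  smul_ad : ∀ (γ : Γ) (h : H) (a : A), γ • ad h a = ad (stableHom H smul_H γ h) (γ • a)
  -- the anti-involution commutes with `Γ`
  smul_inv : ∀ (γ : Γ) (a : A), inv (γ • a) = γ • inv a
  -- `Γ` preserves `P * 0_G` and its action on the weights
  smul_P : ∀ (γ : Γ) (θ : P), ∃ θ' : P, wtAct H smul_H γ (θ • zeroG) = θ' • zeroG ∧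
    ∀ μ : H →ₐ[k] k, wtAct H smul_H γ (θ • μ) = θ' • wtAct H smul_H γ μ
  -- `Γ` preserves the order on the restricted weights
  smul_le : ∀ (γ : Γ) (μ μ' : H0 →ₐ[k] k), toRTAData.le0 μ μ' →
    toRTAData.le0 (wtAct H0 smul_H0 γ μ) (wtAct H0 smul_H0 γ μ')

/-- The inclusion of `A` into the skew group ring `A ⋊ Γ`. -/
def skewIncl (k A Γ : Type*) [Field k] [Ring A] [Algebra k A] [Group Γ]
    [MulSemiringAction Γ A] [SMulCommClass Γ k A] : A →ₐ[k] SkewMonoidAlgebra A Γ where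
  toFun a := SkewMonoidAlgebra.single 1 a
  map_one' := rfl
  map_mul' a b := by simp [SkewMonoidAlgebra.single_mul_single]
  map_zero' := by simp
  map_add' a b := SkewMonoidAlgebra.single_add 1 a b
  commutes' r := rfl

namespace SkewRTA

variable {k A Γ : Type u} [Field k] [Ring A] [Algebra k A] [Group Γ]
  [MulSemiringAction Γ A] [SMulCommClass Γ k A] (D : SkewRTA k A Γ)

/-- The action of `Γ` on the set of weights `G`. -/
def act (γ : Γ) (μ : D.H →ₐ[k] k) : D.H →ₐ[k] k := wtAct D.H D.smul_H γ μ

/-- The subalgebra `H ⋊ Γ` of `A ⋊ Γ`. -/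
def HΓ : Subalgebra k (SkewMonoidAlgebra A Γ) where
  carrier := {r | ∀ γ, r.coeff γ ∈ D.H}
  mul_mem' := by
    classical
    intro a b ha hb γ
    rw [SkewMonoidAlgebra.coeff_mul]
    refine D.H.sum_mem fun γ₁ _ => D.H.sum_mem fun γ₂ _ => ?_
    dsimp only
    split_ifs
    · exact D.H.mul_mem (ha γ₁) (D.smul_H _ _ (hb γ₂))
    · exact D.H.zero_mem
  add_mem' := by
    intro a b ha hb γ
    simpa using D.H.add_mem (ha γ) (hb γ)
  algebraMap_mem' := by
    classical
    intro r γ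
    change (SkewMonoidAlgebra.single (1 : Γ) (algebraMap k A r)).coeff γ ∈ D.H
    rw [SkewMonoidAlgebra.coeff_single_apply]
    split_ifs
    · exact D.H.algebraMap_mem r
    · exact D.H.zero_mem

/-- The inclusion `H → H ⋊ Γ`. -/
def inclH : D.H →ₐ[k] D.HΓ :=
  ((skewIncl k A Γ).comp D.H.val).codRestrict D.HΓ <| by
    classical
    intro h γ
    change (SkewMonoidAlgebra.single (1 : Γ) (h : A)).coeff γ ∈ D.H
    rw [SkewMonoidAlgebra.coeff_single_apply]
    split_ifs
    · exact h.2
    · exact D.H.zero_mem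

/-- The representation of `H` on an `(A ⋊ Γ)`-module. -/
def rhoH (M : Type*) [AddCommGroup M] [Module k M] [Module (SkewMonoidAlgebra A Γ) M]
    [IsScalarTower k (SkewMonoidAlgebra A Γ) M] : D.H →ₐ[k] Module.End k M :=
  (Algebra.lsmul k k M).comp ((skewIncl k A Γ).comp D.H.val)

/-- The simple objects of the category `𝒞` of finite-dimensional `H`-semisimple
`(H ⋊ Γ)`-modules; the set `X` consists of their isomorphism classes. -/
structure X where
  /-- the underlying module `M_x` -/
  V : Type u
  [addCommGroup : AddCommGroup V]
  [module : Module k V]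
  [moduleHΓ : Module D.HΓ V]
  [tower : IsScalarTower k D.HΓ V]
  finite : FiniteDimensional k V
  semisimple : ⨆ μ : D.H →ₐ[k] k, wtSpace ((Algebra.lsmul k k V).comp D.inclH) μ = ⊤
  simple : IsSimpleModule D.HΓ V

attribute [instance] X.addCommGroup X.module X.moduleHΓ X.tower

variable {D}

/-- The set of weights `λ_x` of `x`. (It is a single `Γ`-orbit.) -/
def X.wts (x : D.X) : Set (D.H →ₐ[k] k) :=
  {μ | wtSpace ((Algebra.lsmul k k x.V).comp D.inclH) μ ≠ ⊥}

/-- The relations defining the module induced from the `(H ⊗ B₊) ⋊ Γ`-module `M_x`, on which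
`N₊` acts by `0` and `H ⋊ Γ` acts as given. -/
def X.rel (x : D.X) : Submodule (SkewMonoidAlgebra A Γ) (SkewMonoidAlgebra A Γ ⊗[k] x.V) :=
  Submodule.span (SkewMonoidAlgebra A Γ)
    ({t | ∃ n ∈ D.aug D.Bp, ∃ v : x.V, t = skewIncl k A Γ n ⊗ₜ[k] v} ∪
      {t | ∃ (s : D.HΓ) (v : x.V),
        t = (s : SkewMonoidAlgebra A Γ) ⊗ₜ[k] v -
          (1 : SkewMonoidAlgebra A Γ) ⊗ₜ[k] (s • v)})

/-- The Verma module `Z(x) = Ind M_x = (A ⋊ Γ) ⊗_{(H ⊗ B₊) ⋊ Γ} M_x`. -/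
abbrev X.Verma (x : D.X) : Type u := (SkewMonoidAlgebra A Γ ⊗[k] x.V) ⧸ x.rel

/-- The center of `A ⋊ Γ` acts on the Verma module `Z(x)` by the algebra map `χ`. -/
def X.ActsBy (x : D.X) (χ : Subalgebra.center k (SkewMonoidAlgebra A Γ) →ₐ[k] k) : Prop :=
  ∀ (z : Subalgebra.center k (SkewMonoidAlgebra A Γ)) (m : x.Verma),
    (z : SkewMonoidAlgebra A Γ) • m = χ z • m

variable (D)

open Classical in
/-- The map `χ_μ : A ⋊ Γ → kΓ`, `∑ a_γ γ ↦ ∑_{γ μ = μ} μ(ξ(a_γ)) γ`. -/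
def centralChar (μ : D.H →ₐ[k] k) (r : SkewMonoidAlgebra A Γ) : MonoidAlgebra k Γ :=
  r.sum fun γ a => if D.act γ μ = μ then MonoidAlgebra.single γ (μ (D.hc a)) else 0

/-! ### The category `𝒪` -/

/-- Membership in the category `𝒪`: finitely generated `H`-semisimple `(A ⋊ Γ)`-modules with
finite-dimensional weight spaces and a locally finite action of `B₊`. -/
structure IsO (M : Type*) [AddCommGroup M] [Module k M] [Module (SkewMonoidAlgebra A Γ) M]
    [IsScalarTower k (SkewMonoidAlgebra A Γ) M] : Prop where
  fg : Module.Finite (SkewMonoidAlgebra A Γ) M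
  semisimple : ⨆ μ : D.H →ₐ[k] k, wtSpace (D.rhoH M) μ = ⊤
  finite_wt : ∀ μ : D.H →ₐ[k] k, FiniteDimensional k (wtSpace (D.rhoH M) μ)
  locally_finite : ∀ m : M,
    FiniteDimensional k (Submodule.span k {m' : M | ∃ b ∈ D.Bp, m' = skewIncl k A Γ b • m})

/-- Membership in the subcategory `𝒪(ν)`, for an algebra map `ν` from the center to `k`: every
`z - ν(z)` acts locally nilpotently. -/
structure IsOν (ν : Subalgebra.center k (SkewMonoidAlgebra A Γ) →ₐ[k] k)
    (M : Type*) [AddCommGroup M] [Module k M] [Module (SkewMonoidAlgebra A Γ) M]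
    [IsScalarTower k (SkewMonoidAlgebra A Γ) M] : Prop where
  isO : D.IsO M
  nilpotent : ∀ (m : M) (z : Subalgebra.center k (SkewMonoidAlgebra A Γ)), ∃ n : ℕ,
    ((z : SkewMonoidAlgebra A Γ) - algebraMap k (SkewMonoidAlgebra A Γ) (ν z)) ^ n • m = 0

/-- The set `Θ` of all characters by which the center acts on Verma modules. -/
def Theta : Set (Subalgebra.center k (SkewMonoidAlgebra A Γ) →ₐ[k] k) :=
  {ν | ∃ x : D.X, x.ActsBy ν}

/-- `𝒪 = ⨁_{ν ∈ T} 𝒪(ν)`: every object of `𝒪` is the direct sum of finitely many submodules which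
are objects of subcategories `𝒪(ν)` for distinct `ν ∈ T`, and there are no nonzero
homomorphisms between objects of distinct `𝒪(ν)`. -/
structure IsDirectSumO (T : Set (Subalgebra.center k (SkewMonoidAlgebra A Γ) →ₐ[k] k)) :
    Prop where
  decomp : ∀ (M : Type u) [AddCommGroup M] [Module k M] [Module (SkewMonoidAlgebra A Γ) M]
    [IsScalarTower k (SkewMonoidAlgebra A Γ) M], D.IsO M →
    ∃ N : T → Submodule (SkewMonoidAlgebra A Γ) M,
      (∀ ν : T, D.IsOν ν.1 (N ν)) ∧ iSupIndep N ∧ ⨆ ν, N ν = ⊤ ∧ {ν | N ν ≠ ⊥}.Finite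
  hom_eq_zero : ∀ (ν ν' : T), ν ≠ ν' →
    ∀ (M M' : Type u) [AddCommGroup M] [Module k M] [Module (SkewMonoidAlgebra A Γ) M]
      [IsScalarTower k (SkewMonoidAlgebra A Γ) M]
      [AddCommGroup M'] [Module k M'] [Module (SkewMonoidAlgebra A Γ) M']
      [IsScalarTower k (SkewMonoidAlgebra A Γ) M'],
      D.IsOν ν.1 M → D.IsOν ν'.1 M' →
      ∀ f : M →ₗ[SkewMonoidAlgebra A Γ] M', f = 0

end SkewRTA

end

noncomputable section

/-! ### Linear algebra -/

/-! Central elements commute with `H`, hence preserve weight spaces. This drives both halves of the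
theorem.

Central characters. As `Z(x)` is generated by `M_x`, a central `z` is determined on `Z(x)` by its
values on `M_x`. The triangular decomposition gives `Z(x) = B₋ M_x`, so a weight of `Z(x)` is `θ •
μ` with `μ` a weight of `M_x` and `-π(θ)` in the cone. If `θ • μ` lies in the orbit of `μ`,
finiteness of `Γ`, invariance of the order and pointedness of the cone force `π(θ) = 0`, where `B₋`
has only scalars (`piP_eq_zero_of_act`, `X.mem_range_incl`). Hence `z` maps `M_x` into itself,
commutes with `H ⋊ Γ`, and is a scalar by Schur's lemma. To evaluate the scalar, `ξ` is extended to
`projHΓ : A ⋊ Γ → H ⋊ Γ`, which is right `H ⋊ Γ`-linear and kills `(A ⋊ Γ) N₊`. It therefore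
descends to a retraction `Z(x) → M_x` (`X.exists_proj`). This shows `Z(x) ≠ 0` and yields `χ(z) =
μ(ξ(z))` for `z` in `A`.

Block decomposition. Every nonzero submodule of a module in `𝒪` contains a nonzero singular weight
vector, hence a copy of some `M_x` killed by `N₊`, hence a nonzero vector on which the center acts
by some `θ_x` (`IsO.exists_center_eigenvector`). Applied to the kernel of `q(z)`, this shows that
every irreducible `q` with a nonzero kernel has a root in `k`, so `z` has generalized eigenspaces
spanning each finite-dimensional weight space although `k` need not be closed. Applied to a joint
generalized eigenspace, it shows that the eigencharacter is in `Θ`. Joint generalized eigenspaces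
are independent submodules, and finite generation leaves only finitely many nonzero. -/

theorem iSupIndep.eq_of_le_of_iSup_eq_top {ι α : Type*} [CompleteLattice α] [IsModularLattice α]
    {S T : ι → α} (hT : iSupIndep T) (hle : ∀ i, S i ≤ T i) (hS : ⨆ i, S i = ⊤) (i : ι) :
    S i = T i := by
  refine le_antisymm (hle i) ?_
  have h1 : S i ⊔ ⨆ (j) (_ : j ≠ i), S j = ⊤ := by
    rw [eq_top_iff, ← hS]
    refine iSup_le fun j => ?_
    by_cases h : j = i
    · subst h; exact le_sup_left
    · exact le_sup_of_le_right (le_iSup₂_of_le j h le_rfl)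
  have h2 : Disjoint (T i) (⨆ (j) (_ : j ≠ i), S j) :=
    (hT i).mono_right (iSup₂_mono fun j _ => hle j)
  calc T i = (S i ⊔ ⨆ (j) (_ : j ≠ i), S j) ⊓ T i := by rw [h1, top_inf_eq]
    _ = S i ⊔ (⨆ (j) (_ : j ≠ i), S j) ⊓ T i := by rw [sup_inf_assoc_of_le _ (hle i)]
    _ = S i := by rw [inf_comm, h2.eq_bot, sup_bot_eq]
    _ ≤ S i := le_rfl

/-- A vector in a sum of members of an independent family that lies in one member with index
outside the summation set vanishes. -/
theorem iSupIndep.eq_zero_of_mem {ι k M : Type*} [Field k] [AddCommGroup M] [Module k M]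
    {T : ι → Submodule k M} (hT : iSupIndep T) {i : ι} {m : M} (hm : m ∈ T i) {p : ι → Prop}
    (hi : ¬ p i) (hm' : m ∈ ⨆ (j) (_ : p j), T j) : m = 0 := by
  refine Submodule.disjoint_def.1 (hT i) m hm ?_
  refine (iSup₂_le fun j hj => ?_ : (⨆ (j) (_ : p j), T j) ≤ _) hm'
  exact le_iSup₂_of_le (f := fun j (_ : j ≠ i) => T j) j (fun h => hi (h ▸ hj)) le_rfl

/-- Multiply one normalized factor `h - ν(h)` for each `ν` in `s`, with `h` chosen so that `μ(h) ≠
ν(h)`. -/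
theorem exists_separating {k H : Type*} [Field k] [CommRing H] [Algebra k H]
    (μ : H →ₐ[k] k) (s : Finset (H →ₐ[k] k)) (hs : μ ∉ s) :
    ∃ e : H, μ e = 1 ∧ ∀ μ' ∈ s, μ' e = 0 := by
  classical
  induction s using Finset.induction_on with
  | empty => exact ⟨1, map_one μ, by simp⟩
  | insert ν s _ ih =>
    rw [Finset.mem_insert, not_or] at hs
    obtain ⟨e, he, hes⟩ := ih hs.2
    obtain ⟨h, hh⟩ : ∃ h, μ h ≠ ν h := by
      by_contra! hcon
      exact hs.1 (AlgHom.ext hcon)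
    refine ⟨e * ((μ h - ν h)⁻¹ • (h - algebraMap k H (ν h))), ?_, ?_⟩
    · rw [map_mul, he, map_smul, map_sub, AlgHom.commutes, smul_eq_mul, one_mul]
      exact inv_mul_cancel₀ (sub_ne_zero.2 hh)
    · intro μ' hμ'
      rcases Finset.mem_insert.1 hμ' with rfl | hμ'
      · rw [map_mul, map_smul, map_sub, AlgHom.commutes]
        simp
      · rw [map_mul, hes μ' hμ', zero_mul]

/-- A subspace of an `H`-semisimple module that is stable under `H` is `H`-semisimple. -/
theorem le_iSup_inf_wtSpace {k H M : Type*} [Field k] [Ring H] [Algebra k H] [AddCommGroup M]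
    [Module k M] (ρ : H →ₐ[k] Module.End k M) (hcomm : ∀ a b : H, a * b = b * a)
    (htop : ⨆ μ, wtSpace ρ μ = ⊤) (N : Submodule k M) (hN : ∀ h, ∀ m ∈ N, ρ h m ∈ N) :
    N ≤ ⨆ μ, N ⊓ wtSpace ρ μ := by
  classical
  let _ : CommRing H := { (inferInstance : Ring H) with mul_comm := hcomm }
  intro m hm
  obtain ⟨f, hf, hfm⟩ := (Submodule.mem_iSup_iff_exists_finsupp _ _).1
    (htop ▸ Submodule.mem_top : m ∈ ⨆ μ, wtSpace ρ μ)
  rw [← hfm]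
  refine Submodule.sum_mem _ fun μ hμ => Submodule.mem_iSup_of_mem μ ⟨?_, hf μ⟩
  -- On `m`, this `e` acts as the projection to the `μ`-component, which therefore stays in `N`.
  obtain ⟨e, he, hes⟩ := exists_separating μ (f.support.erase μ) (Finset.notMem_erase _ _)
  have : ρ e m = f μ := by
    rw [← hfm, Finsupp.sum, map_sum, Finset.sum_eq_single_of_mem μ hμ, hf μ e, he, one_smul]
    intro ν hν hne
    rw [hf ν e, hes ν (Finset.mem_erase.2 ⟨hne, hν⟩), zero_smul]
  rw [← this]
  exact hN e m hm

/-- Replaces algebraic closedness: only irreducible factors of the minimal polynomial need roots.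
Kernels of coprime factors add up, and a prime power whose prime has a root `c` is associated to a
power of `X - c`. -/
theorem iSup_maxGenEigenspace_eq_top_of_forall_irreducible {k V : Type*} [Field k]
    [AddCommGroup V] [Module k V] [FiniteDimensional k V] (f : Module.End k V)
    (h : ∀ q : Polynomial k, Irreducible q → (∃ v ≠ 0, Polynomial.aeval f q v = 0) →
      ∃ c, q.IsRoot c) :
    ⨆ c, f.maxGenEigenspace c = ⊤ := by
  have hroot : ∀ q : Polynomial k, Irreducible q → q ∣ minpoly k f → ∃ c, q.IsRoot c := by
    rintro q hq ⟨r, hr⟩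
    refine h q hq ?_
    have hmin := minpoly.ne_zero (Algebra.IsIntegral.isIntegral (R := k) f)
    have hr0 : r ≠ 0 := by rintro rfl; exact hmin (by rw [hr, mul_zero])
    -- The cofactor `r` has smaller degree than the minimal polynomial, so it does not kill
    -- everything, and `q` kills its image.
    have hrf : Polynomial.aeval f r ≠ 0 := by
      intro h0
      have h1 := Polynomial.natDegree_le_of_dvd (minpoly.dvd k f h0) hr0
      rw [hr, Polynomial.natDegree_mul hq.ne_zero hr0] at h1
      have := hq.natDegree_pos
      omega
    obtain ⟨v, hv⟩ : ∃ v, Polynomial.aeval f r v ≠ 0 := by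
      by_contra! hcon
      exact hrf (LinearMap.ext hcon)
    refine ⟨_, hv, ?_⟩
    rw [← Module.End.mul_apply, ← map_mul, ← hr, minpoly.aeval, LinearMap.zero_apply]
  have key : ∀ p : Polynomial k, p ∣ minpoly k f →
      LinearMap.ker (Polynomial.aeval f p) ≤ ⨆ c, f.maxGenEigenspace c := by
    intro p
    induction p using UniqueFactorizationMonoid.induction_on_coprime with
    | h0 =>
      intro h0
      exact absurd (zero_dvd_iff.1 h0) (minpoly.ne_zero (Algebra.IsIntegral.isIntegral (R := k) f))
    | h1 hx =>
      rename_i u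
      intro _ v hv
      obtain ⟨g, hg⟩ := hx.exists_left_inv
      have : v = Polynomial.aeval f g (Polynomial.aeval f u v) := by
        rw [← Module.End.mul_apply, ← map_mul, hg, map_one, Module.End.one_apply]
      rw [this, LinearMap.mem_ker.1 hv, map_zero]
      exact Submodule.zero_mem _
    | hpr i hq =>
      rename_i q
      intro hd
      by_cases hi : i = 0
      · subst hi
        intro v hv
        have : v = 0 := by simpa using hv
        rw [this]; exact Submodule.zero_mem _
      obtain ⟨c, hc⟩ := hroot q hq.irreducible ((dvd_pow_self q hi).trans hd)
      have hass := (Polynomial.irreducible_X_sub_C c).associated_of_dvd hq.irreducible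
        (Polynomial.dvd_iff_isRoot.2 hc)
      obtain ⟨g, hg⟩ := (hass.pow_pow (n := i)).symm.dvd
      intro v hv
      refine Submodule.mem_iSup_of_mem c ?_
      rw [Module.End.mem_maxGenEigenspace]
      refine ⟨i, ?_⟩
      have e : (f - c • 1) ^ i = Polynomial.aeval f ((Polynomial.X - Polynomial.C c) ^ i) := by
        rw [map_pow, map_sub, Polynomial.aeval_X, Polynomial.aeval_C, Algebra.algebraMap_eq_smul_one]
      rw [e, hg, mul_comm, map_mul, Module.End.mul_apply, LinearMap.mem_ker.1 hv, map_zero]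
    | hcp hxy hx hy =>
      intro hd
      rw [← Polynomial.sup_ker_aeval_eq_ker_aeval_mul_of_coprime f hxy.isCoprime]
      exact sup_le (hx ((dvd_mul_right _ _).trans hd)) (hy ((dvd_mul_left _ _).trans hd))
  rw [eq_top_iff]
  refine le_trans ?_ (key _ dvd_rfl)
  rw [minpoly.aeval, LinearMap.ker_zero]

/-! ### Weights of a regular triangular algebra -/

namespace RTAData

variable {k A : Type u} [Field k] [Ring A] [Algebra k A] (D : RTAData k A)

/-- The height of an element of the root lattice: the sum of its coordinates. -/
def height : D.P0 →+ ℤ :=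
  ∑ i, (Finsupp.applyAddHom i).comp D.Δ.repr.toLinearMap.toAddMonoidHom

theorem height_apply (a : D.P0) : D.height a = ∑ i, D.Δ.repr a i := by
  simp [height]

theorem repr_nonneg {a : D.P0} (ha : a ∈ D.cone) (i : Fin D.rk) : 0 ≤ D.Δ.repr a i := by
  induction ha using AddSubmonoid.closure_induction with
  | mem x hx =>
    obtain ⟨j, rfl⟩ := hx
    rw [Module.Basis.repr_self, Finsupp.single_apply]
    split_ifs <;> simp
  | zero => simp
  | add x y _ _ hx hy => rw [map_add, Finsupp.add_apply]; exact add_nonneg hx hy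

theorem height_nonneg {a : D.P0} (ha : a ∈ D.cone) : 0 ≤ D.height a := by
  rw [height_apply]
  exact Finset.sum_nonneg fun i _ => D.repr_nonneg ha i

theorem eq_zero_of_height {a : D.P0} (ha : a ∈ D.cone) (h : D.height a = 0) : a = 0 := by
  rw [height_apply, Finset.sum_eq_zero_iff_of_nonneg fun i _ => D.repr_nonneg ha i] at h
  exact D.Δ.ext_elem fun i => by simpa using h i (Finset.mem_univ i)

theorem height_pos {a : D.P0} (ha : a ∈ D.cone) (h : a ≠ 0) : 0 < D.height a :=
  lt_of_le_of_ne (D.height_nonneg ha) fun h0 => h (D.eq_zero_of_height ha h0.symm)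

theorem cone_pointed {a b : D.P0} (ha : a ∈ D.cone) (hb : b ∈ D.cone) (h : a + b = 0) :
    a = 0 := by
  refine D.eq_zero_of_height ha ?_
  have := congrArg D.height h
  rw [map_add, map_zero] at this
  have h1 := D.height_nonneg ha
  have h2 := D.height_nonneg hb
  omega

theorem le0_trans {a b c : D.H0 →ₐ[k] k} (hab : D.le0 a b) (hbc : D.le0 b c) : D.le0 a c := by
  obtain ⟨x, hx, rfl⟩ := hab
  obtain ⟨y, hy, rfl⟩ := hbc
  exact ⟨y + x, add_mem hy hx, add_vadd _ _ _⟩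

end RTAData

namespace RTA

variable {k A : Type u} [Field k] [Ring A] [Algebra k A] (D : RTA k A)

/-- The weight space `A_θ` for the adjoint action. -/
abbrev wt (θ : D.P) : Submodule k A := wtSpace D.ad (θ • D.zeroG)

theorem smul_left_injective (μ : D.H →ₐ[k] k) : Function.Injective fun θ : D.P => θ • μ := by
  intro a b hab
  have h : (b⁻¹ * a) • μ = μ := by
    rw [mul_smul, inv_smul_eq_iff]
    exact hab
  have := D.free_P _ _ h
  rwa [inv_mul_eq_one, eq_comm] at this

theorem iSupIndep_wt : iSupIndep D.wt :=
  (iSupIndep_wtSpace D.ad D.H_comm).comp (D.smul_left_injective D.zeroG)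

theorem vadd_left_injective (μ : D.H0 →ₐ[k] k) : Function.Injective fun a : D.P0 => a +ᵥ μ := by
  intro a b hab
  have h : (-b + a) +ᵥ μ = μ := by
    rw [add_vadd, neg_vadd_eq_iff]
    exact hab
  have := D.free_P0 _ _ h
  rwa [neg_add_eq_zero, eq_comm] at this

/-- Multiplicativity of `π` is not an axiom. It follows by comparing actions on one restricted
weight, since `P₀` acts freely. -/
theorem piP_mul (θ θ' : D.P) : D.piP (θ * θ') = D.piP θ + D.piP θ' := by
  apply D.vadd_left_injective (D.res D.zeroG)
  change D.piP (θ * θ') +ᵥ _ = (D.piP θ + D.piP θ') +ᵥ _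
  rw [← D.res_smul, mul_smul, D.res_smul, D.res_smul, add_vadd]

theorem H_le_wt_one {a : A} (ha : a ∈ D.H) : a ∈ D.wt 1 := fun h => by
  rw [one_smul]; exact D.ad_zeroG h a ha

theorem mul_mem_wt {θ θ' : D.P} {a b : A} (ha : a ∈ D.wt θ) (hb : b ∈ D.wt θ') :
    a * b ∈ D.wt (θ * θ') := D.weights_mul θ θ' a ha b hb

theorem mem_span_one_of_Bp {b : A} (hb : b ∈ D.Bp) {θ : D.P} (hθ : b ∈ D.wt θ)
    (h : D.piP θ = 0) : b ∈ Submodule.span k {(1 : A)} := by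
  rw [← D.Bp_zero]
  refine Submodule.mem_iSup_of_mem (θ • D.zeroG) (Submodule.mem_iSup_of_mem ?_ ⟨hb, hθ⟩)
  rw [D.res_smul, h]

theorem mem_span_one_of_Bm {b : A} (hb : b ∈ D.Bm) {θ : D.P} (hθ : b ∈ D.wt θ)
    (h : D.piP θ = 0) : b ∈ Submodule.span k {(1 : A)} := by
  rw [← D.Bm_zero]
  refine Submodule.mem_iSup_of_mem (θ • D.zeroG) (Submodule.mem_iSup_of_mem ?_ ⟨hb, hθ⟩)
  rw [D.res_smul, h]

theorem mem_aug {B : Subalgebra k A} {b : A} (hb : b ∈ B) {θ : D.P} (hθ : b ∈ D.wt θ)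
    (h : D.piP θ ≠ 0) : b ∈ D.aug B :=
  Submodule.mem_iSup_of_mem θ (Submodule.mem_iSup_of_mem h ⟨hb, hθ⟩)

theorem aug_le (B : Subalgebra k A) : D.aug B ≤ Subalgebra.toSubmodule B :=
  iSup₂_le fun _ _ => inf_le_left

theorem epsP_eq_zero {b : D.Bp} {θ : D.P} (hθ : (b : A) ∈ D.wt θ) (h : D.piP θ ≠ 0) :
    D.epsP b = 0 :=
  D.epsP_spec.2 b (D.mem_aug b.2 hθ h)

theorem epsM_eq_zero {b : D.Bm} {θ : D.P} (hθ : (b : A) ∈ D.wt θ) (h : D.piP θ ≠ 0) :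
    D.epsM b = 0 :=
  D.epsM_spec.2 b (D.mem_aug b.2 hθ h)

@[elab_as_elim]
theorem Bp_induction {p : ∀ b : A, b ∈ D.Bp → Prop} (h0 : p 0 D.Bp.zero_mem)
    (hadd : ∀ a b ha hb, p a ha → p b hb → p (a + b) (D.Bp.add_mem ha hb))
    (hwt : ∀ θ, D.piP θ ∈ D.cone → ∀ b (hb : b ∈ D.Bp), b ∈ D.wt θ → p b hb) {b : A}
    (hb : b ∈ D.Bp) : p b hb := by
  have hb' : b ∈ Subalgebra.toSubmodule D.Bp := hb
  rw [D.Bp_decomp, iSup_subtype'] at hb'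
  obtain ⟨_, h⟩ := Submodule.iSup_induction _ (motive := fun b => ∃ hb, p b hb) hb'
    (fun θ x hx => ⟨hx.1, hwt θ.1 θ.2 x hx.1 hx.2⟩) ⟨_, h0⟩
    (fun a b ⟨ha, hpa⟩ ⟨hb, hpb⟩ => ⟨_, hadd a b ha hb hpa hpb⟩)
  exact h

@[elab_as_elim]
theorem Bm_induction {p : ∀ b : A, b ∈ D.Bm → Prop} (h0 : p 0 D.Bm.zero_mem)
    (hadd : ∀ a b ha hb, p a ha → p b hb → p (a + b) (D.Bm.add_mem ha hb))
    (hwt : ∀ θ, -D.piP θ ∈ D.cone → ∀ b (hb : b ∈ D.Bm), b ∈ D.wt θ → p b hb) {b : A}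
    (hb : b ∈ D.Bm) : p b hb := by
  have hb' : b ∈ Subalgebra.toSubmodule D.Bm := hb
  rw [D.Bm_decomp, iSup_subtype'] at hb'
  obtain ⟨_, h⟩ := Submodule.iSup_induction _ (motive := fun b => ∃ hb, p b hb) hb'
    (fun θ x hx => ⟨hx.1, hwt θ.1 θ.2 x hx.1 hx.2⟩) ⟨_, h0⟩
    (fun a b ⟨ha, hpa⟩ ⟨hb, hpb⟩ => ⟨_, hadd a b ha hb hpa hpb⟩)
  exact h

/-- `N₊` is spanned by its weight vectors of weights in `ℤ≥0 Δ`. -/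
@[elab_as_elim]
theorem aug_Bp_induction {p : ∀ b : A, b ∈ D.aug D.Bp → Prop} (h0 : p 0 (Submodule.zero_mem _))
    (hadd : ∀ a b ha hb, p a ha → p b hb → p (a + b) (Submodule.add_mem _ ha hb))
    (hwt : ∀ θ, D.piP θ ∈ D.cone → D.piP θ ≠ 0 → ∀ b (_ : b ∈ D.Bp) (_ : b ∈ D.wt θ)
      (hb : b ∈ D.aug D.Bp), p b hb) {b : A} (hb : b ∈ D.aug D.Bp) : p b hb := by
  have hb' := hb
  rw [RTAData.aug, iSup_subtype'] at hb'
  suffices ∃ hb, p b hb from this.2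
  refine Submodule.iSup_induction _ (motive := fun b => ∃ hb, p b hb) hb'
    (fun θ x hx => ?_) ⟨_, h0⟩
    (fun a b ⟨ha, hpa⟩ ⟨hb, hpb⟩ => ⟨_, hadd a b ha hb hpa hpb⟩)
  refine ⟨D.mem_aug hx.1 hx.2 θ.2, ?_⟩
  by_cases h : D.piP θ.1 ∈ D.cone
  · exact hwt θ.1 h θ.2 x hx.1 hx.2 _
  -- The definition of `aug` also admits weights outside the cone. By `Bp_decomp` and independence,
  -- `B₊` has no nonzero vectors there.
  · have hx1 : x ∈ Subalgebra.toSubmodule D.Bp := hx.1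
    rw [D.Bp_decomp] at hx1
    have hx0 := D.iSupIndep_wt.eq_zero_of_mem (p := fun θ => D.piP θ ∈ D.cone) hx.2 h
      ((iSup₂_mono fun _ _ => inf_le_right :
        (⨆ (θ : D.P) (_ : D.piP θ ∈ D.cone), D.adWt D.Bp.toSubmodule (θ • D.zeroG)) ≤ _) hx1)
    subst hx0
    exact h0

/-- `N₊` is a left ideal of `B₊`: by pointedness, adding a cone element to a nonzero cone element
never gives zero. -/
theorem epsP_mul_aug (b n : D.Bp) (hn : (n : A) ∈ D.aug D.Bp) : D.epsP (b * n) = 0 := by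
  suffices ∀ n ∈ D.aug D.Bp, ∀ b ∈ D.Bp, b * n ∈ D.aug D.Bp from
    D.epsP_spec.2 _ (this n hn b b.2)
  intro n hn b hb
  induction hn using D.aug_Bp_induction with
  | h0 => rw [mul_zero]; exact Submodule.zero_mem _
  | hadd x y _ _ hx hy => rw [mul_add]; exact Submodule.add_mem _ hx hy
  | hwt θ hθ hθ0 n hnB hn _ =>
    induction hb using D.Bp_induction with
    | h0 => rw [zero_mul]; exact Submodule.zero_mem _
    | hadd x y _ _ hx hy => rw [add_mul]; exact Submodule.add_mem _ hx hy
    | hwt θ' hθ' b hbB hb =>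
      refine D.mem_aug (D.Bp.mul_mem hbB hnB) (D.mul_mem_wt hb hn) ?_
      rw [D.piP_mul, add_comm]
      exact fun h => hθ0 (D.cone_pointed hθ hθ' h)

/-! ### The Harish-Chandra projection -/

theorem hc_mul (b : D.Bm) (h : D.H) (b' : D.Bp) :
    D.hc (b * h * b') = (D.epsM b * D.epsP b') • h := by
  have e : D.triEquiv.symm ((b : A) * h * b') = (b ⊗ₜ h) ⊗ₜ b' := by
    rw [LinearEquiv.symm_apply_eq]
    rfl
  simp only [hc, LinearMap.comp_apply, LinearEquiv.coe_coe, e, TensorProduct.map_tmul,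
    TensorProduct.lid_tmul, TensorProduct.rid_tmul, LinearMap.id_apply]
  rw [smul_smul, mul_comm]

@[elab_as_elim]
theorem tri_induction {p : A → Prop} (h0 : p 0) (hadd : ∀ a b, p a → p b → p (a + b))
    (hmul : ∀ (b : D.Bm) (h : D.H) (b' : D.Bp), p (b * h * b')) (a : A) : p a := by
  obtain ⟨t, rfl⟩ := D.triangular.2 a
  induction t using TensorProduct.induction_on with
  | zero => rw [map_zero]; exact h0
  | add x y hx hy => rw [map_add]; exact hadd _ _ hx hy
  | tmul s b' =>
    induction s using TensorProduct.induction_on with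
    | zero => rw [TensorProduct.zero_tmul, map_zero]; exact h0
    | add x y hx hy => rw [TensorProduct.add_tmul, map_add]; exact hadd _ _ hx hy
    | tmul b h => exact hmul b h b'

theorem hc_H (h : D.H) : D.hc h = h := by
  have := D.hc_mul 1 h 1
  rw [D.epsM_spec.1, D.epsP_spec.1, mul_one, one_smul] at this
  simpa using this

theorem hc_mul_aug (a n : A) (hn : n ∈ D.aug D.Bp) : D.hc (a * n) = 0 := by
  induction a using D.tri_induction with
  | h0 => rw [zero_mul, map_zero]
  | hadd a b ha hb => rw [add_mul, map_add, ha, hb, add_zero]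
  | hmul b h b' =>
    have := D.hc_mul b h (b' * ⟨n, D.aug_le _ hn⟩)
    rw [D.epsP_mul_aug _ _ hn, mul_zero, zero_smul] at this
    rw [← this]
    simp [mul_assoc]

/-- Products of weight vectors of `B₋`, `H`, `B₊` with total weight `θ`. -/
def triWt (θ : D.P) : Submodule k A :=
  Submodule.span k {a | ∃ θ₁ θ₂ : D.P, θ₁ * θ₂ = θ ∧ ∃ (b : D.Bm) (h : D.H) (b' : D.Bp),
    (b : A) ∈ D.wt θ₁ ∧ (b' : A) ∈ D.wt θ₂ ∧ a = b * h * b'}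

/-- The spans lie in the independent family of weight spaces and together exhaust `A`, so each
inclusion is an equality. -/
theorem triWt_eq (θ : D.P) : D.triWt θ = D.wt θ := by
  refine D.iSupIndep_wt.eq_of_le_of_iSup_eq_top (fun θ => ?_) ?_ θ
  · refine Submodule.span_le.2 ?_
    rintro _ ⟨θ₁, θ₂, rfl, b, h, b', hb, hb', rfl⟩
    have := D.mul_mem_wt (D.mul_mem_wt hb (D.H_le_wt_one h.2)) hb'
    rwa [mul_one] at this
  · rw [eq_top_iff]
    intro a _
    induction a using D.tri_induction with
    | h0 => exact Submodule.zero_mem _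
    | hadd a b ha hb => exact Submodule.add_mem _ (ha trivial) (hb trivial)
    | hmul b h b' =>
      obtain ⟨b, hb⟩ := b
      obtain ⟨b', hb'⟩ := b'
      induction hb using D.Bm_induction with
      | h0 => simp
      | hadd x y _ _ hx hy =>
        simp only [add_mul]; exact Submodule.add_mem _ (hx trivial) (hy trivial)
      | hwt θ₁ _ b hbB hb =>
        induction hb' using D.Bp_induction with
        | h0 => simp
        | hadd x y _ _ hx hy =>
          simp only [mul_add]; exact Submodule.add_mem _ (hx trivial) (hy trivial)
        | hwt θ₂ _ b' hbB' hb' =>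
          exact Submodule.mem_iSup_of_mem (θ₁ * θ₂) (Submodule.subset_span
            ⟨θ₁, θ₂, rfl, ⟨b, hbB⟩, h, ⟨b', hbB'⟩, hb, hb', rfl⟩)

/-- In a product of weight vectors of this total weight, the `B₋` or the `B₊` factor has nonzero
restricted weight and is killed by its augmentation. -/
theorem hc_eq_zero_of_mem_wt {θ : D.P} (hθ : D.piP θ ≠ 0) {a : A} (ha : a ∈ D.wt θ) :
    D.hc a = 0 := by
  rw [← D.triWt_eq] at ha
  induction ha using Submodule.span_induction with
  | mem x hx =>
    obtain ⟨θ₁, θ₂, rfl, b, h, b', hb, hb', rfl⟩ := hx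
    rw [D.hc_mul]
    by_cases h1 : D.piP θ₁ = 0
    · rw [D.piP_mul, h1, zero_add] at hθ
      rw [D.epsP_eq_zero hb' hθ, mul_zero, zero_smul]
    · rw [D.epsM_eq_zero hb h1, zero_mul, zero_smul]
  | zero => exact map_zero _
  | add x y _ _ hx hy => rw [map_add, hx, hy, add_zero]
  | smul c x _ hx => rw [map_smul, hx, smul_zero]

/-- Formulated for all of `H B₊` because no commutation rule for `b' h` is available: a product `h'
b' h` is only known to lie in this subalgebra. -/
theorem hc_Bm_mul (b : D.Bm) {s : A}
    (hs : s ∈ Subalgebra.toSubmodule D.H * Subalgebra.toSubmodule D.Bp) :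
    D.hc (b * s) = D.epsM b • D.hc s := by
  refine Submodule.mul_induction_on hs (fun h hh b' hb' => ?_) fun x y hx hy => ?_
  · have e1 := D.hc_mul b ⟨h, hh⟩ ⟨b', hb'⟩
    have e2 := D.hc_mul 1 ⟨h, hh⟩ ⟨b', hb'⟩
    rw [D.epsM_spec.1, one_mul] at e2
    simp only [OneMemClass.coe_one, one_mul, mul_assoc] at e1 e2
    rw [e1, e2, smul_smul]
  · rw [mul_add, map_add, hx, hy, map_add, smul_add]

/-- After the `B₋` factor is stripped off, take a weight vector `b'` of `B₊`. Either its restricted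
weight is zero and `b'` is a scalar, or both sides vanish for weight reasons. -/
theorem hc_mul_H (a : A) (h : D.H) : D.hc (a * h) = D.hc a * h := by
  induction a using D.tri_induction with
  | h0 => rw [zero_mul, map_zero, zero_mul]
  | hadd a b ha hb => rw [add_mul, map_add, ha, hb, map_add, add_mul]
  | hmul b h' b' =>
    have hmem : ∀ b' : D.Bp, (h' : A) * b' ∈ D.H.toSubmodule * D.Bp.toSubmodule := fun b' =>
      Submodule.mul_mem_mul h'.2 b'.2
    have hh : (h : A) ∈ D.H.toSubmodule * D.Bp.toSubmodule := by
      simpa using Submodule.mul_mem_mul (show (h : A) ∈ Subalgebra.toSubmodule D.H from h.2)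
        (show (1 : A) ∈ Subalgebra.toSubmodule D.Bp from D.Bp.one_mem)
    rw [mul_assoc (b : A), mul_assoc (b : A), D.hc_Bm_mul b (D.mul_HBp _ (hmem b') _ hh),
      D.hc_Bm_mul b (hmem b'), smul_mul_assoc]
    congr 1
    obtain ⟨b', hb'⟩ := b'
    clear hmem
    induction hb' using D.Bp_induction with
    | h0 => simp
    | hadd x y _ _ hx hy => simp only [mul_add, add_mul, map_add, hx, hy]
    | hwt θ hθ b' hbB hb =>
      by_cases h0 : D.piP θ = 0
      · obtain ⟨c, rfl⟩ := Submodule.mem_span_singleton.1 (D.mem_span_one_of_Bp hbB hb h0)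
        have e := D.hc_H (h' * h)
        rw [MulMemClass.coe_mul] at e
        simp only [mul_smul_comm, mul_one, smul_mul_assoc, map_smul, e, D.hc_H]
      · have e1 := D.mul_mem_wt (D.H_le_wt_one h'.2) hb
        have e2 := D.mul_mem_wt e1 (D.H_le_wt_one h.2)
        rw [one_mul] at e1
        rw [one_mul, mul_one] at e2
        rw [D.hc_eq_zero_of_mem_wt h0 e1, D.hc_eq_zero_of_mem_wt h0 e2, zero_mul]

end RTA

/-! ### The subring `H ⋊ Γ` and the projection onto it -/

namespace SkewRTA

variable {k A Γ : Type u} [Field k] [Ring A] [Algebra k A] [Group Γ]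
  [MulSemiringAction Γ A] [SMulCommClass Γ k A] (D : SkewRTA k A Γ)

theorem skewIncl_apply (a : A) : skewIncl k A Γ a = SkewMonoidAlgebra.single 1 a := rfl

/-- The element `h γ` of `H ⋊ Γ`. -/
def sg (γ : Γ) (h : D.H) : D.HΓ :=
  ⟨SkewMonoidAlgebra.single γ (h : A), by
    classical
    intro γ'
    rw [SkewMonoidAlgebra.coeff_single_apply]
    split_ifs
    · exact h.2
    · exact D.H.zero_mem⟩

theorem coe_sg (γ : Γ) (h : D.H) : (D.sg γ h : SkewMonoidAlgebra A Γ) =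
    SkewMonoidAlgebra.single γ (h : A) := rfl

@[elab_as_elim]
theorem HΓ_induction {p : D.HΓ → Prop} (h0 : p 0) (hadd : ∀ s t, p s → p t → p (s + t))
    (hsg : ∀ γ h, p (D.sg γ h)) (s : D.HΓ) : p s := by
  have e : s = ∑ γ ∈ (s : SkewMonoidAlgebra A Γ).support,
      D.sg γ ⟨(s : SkewMonoidAlgebra A Γ).coeff γ, s.2 γ⟩ := by
    apply Subtype.ext
    rw [AddSubmonoidClass.coe_finsetSum]
    exact (SkewMonoidAlgebra.sum_single (s : SkewMonoidAlgebra A Γ)).symm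
  rw [e]
  exact Finset.sum_induction _ p hadd h0 fun γ _ => hsg γ _

theorem inclH_eq_sg (h : D.H) : D.inclH h = D.sg 1 h := rfl

theorem sg_mul_sg (γ γ' : Γ) (h h' : D.H) :
    D.sg γ h * D.sg γ' h' = D.sg (γ * γ') (h * stableHom D.H D.smul_H γ h') :=
  Subtype.ext (SkewMonoidAlgebra.single_mul_single ..)

theorem sg_eq (γ : Γ) (h : D.H) : D.sg γ h = D.inclH h * D.sg γ 1 := by
  rw [inclH_eq_sg, sg_mul_sg, one_mul, map_one, mul_one]

theorem stableHom_inv (γ : Γ) (h : D.H) :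
    stableHom D.H D.smul_H γ (stableHom D.H D.smul_H γ⁻¹ h) = h :=
  Subtype.ext (smul_inv_smul γ (h : A))

theorem inclH_mul_sg (γ : Γ) (h : D.H) :
    D.inclH h * D.sg γ 1 = D.sg γ 1 * D.inclH (stableHom D.H D.smul_H γ⁻¹ h) := by
  rw [← sg_eq, inclH_eq_sg, sg_mul_sg, one_mul, mul_one, stableHom_inv]

theorem act_apply (γ : Γ) (μ : D.H →ₐ[k] k) (h : D.H) :
    D.act γ μ h = μ (stableHom D.H D.smul_H γ⁻¹ h) := rfl

theorem act_one (μ : D.H →ₐ[k] k) : D.act 1 μ = μ := by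
  ext h
  rw [act_apply]
  congr 1
  apply Subtype.ext
  change (1 : Γ)⁻¹ • (h : A) = h
  rw [inv_one, one_smul]

/-- The Harish-Chandra projection extended to `A ⋊ Γ → H ⋊ Γ`. -/
def projHΓ : SkewMonoidAlgebra A Γ →ₗ[k] D.HΓ where
  toFun r := ⟨⟨r.coeff.mapRange (fun a => (D.hc a : A)) (by rw [map_zero]; rfl)⟩,
    fun γ => (D.hc (r.coeff γ)).2⟩
  map_add' r s := by
    apply Subtype.ext
    ext γ
    have e : (D.hc ((r + s).coeff γ) : A) = D.hc (r.coeff γ) + D.hc (s.coeff γ) := by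
      rw [SkewMonoidAlgebra.coeff_add, Finsupp.add_apply, map_add]; rfl
    refine e.trans ?_
    rw [Subalgebra.coe_add, SkewMonoidAlgebra.coeff_add]
    rfl
  map_smul' c r := by
    apply Subtype.ext
    ext γ
    have e : (D.hc ((c • r).coeff γ) : A) = c • (D.hc (r.coeff γ) : A) := by
      rw [SkewMonoidAlgebra.coeff_smul, Finsupp.smul_apply, map_smul]; rfl
    refine e.trans ?_
    rw [RingHom.id_apply, Subalgebra.coe_smul, SkewMonoidAlgebra.coeff_smul]
    rfl

theorem projHΓ_single (γ : Γ) (a : A) :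
    D.projHΓ (SkewMonoidAlgebra.single γ a) = D.sg γ (D.hc a) := by
  apply Subtype.ext
  apply SkewMonoidAlgebra.coeff_injective
  exact Finsupp.mapRange_single (hf := by rw [map_zero]; rfl)

/-- Reduces to right `H`-linearity of `ξ`. With `projHΓ_mul_aug`, this is exactly compatibility with
the relations of `Z(x)`. -/
theorem projHΓ_mul (r : SkewMonoidAlgebra A Γ) (s : D.HΓ) :
    D.projHΓ (r * s) = D.projHΓ r * s := by
  induction s using D.HΓ_induction with
  | h0 => simp
  | hadd s t hs ht => rw [Subalgebra.coe_add, mul_add, map_add, hs, ht, mul_add]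
  | hsg γ' h =>
    induction r using SkewMonoidAlgebra.induction_on with
    | zero => simp
    | add r r' hr hr' => rw [add_mul, map_add, hr, hr', map_add, add_mul]
    | single γ a =>
      rw [coe_sg, SkewMonoidAlgebra.single_mul_single, projHΓ_single, projHΓ_single, sg_mul_sg,
        ← D.hc_mul_H]
      rfl

theorem projHΓ_mul_aug (r : SkewMonoidAlgebra A Γ) {n : A} (hn : n ∈ D.aug D.Bp) :
    D.projHΓ (r * skewIncl k A Γ n) = 0 := by
  induction r using SkewMonoidAlgebra.induction_on with
  | zero => simp
  | add r r' hr hr' => rw [add_mul, map_add, hr, hr', add_zero]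
  | single γ a =>
    rw [skewIncl_apply, SkewMonoidAlgebra.single_mul_single, projHΓ_single,
      D.hc_mul_aug _ _ (D.smul_Np γ n hn)]
    exact Subtype.ext (SkewMonoidAlgebra.single_zero _)

theorem projHΓ_one : D.projHΓ 1 = 1 := by
  have := D.projHΓ_single 1 1
  rw [show D.hc 1 = 1 from D.hc_H 1] at this
  exact this

/-! ### Weights of modules -/

theorem sg_smul_mem_wtSpace {V : Type*} [AddCommGroup V] [Module k V] [Module D.HΓ V]
    [IsScalarTower k D.HΓ V] (γ : Γ) {μ : D.H →ₐ[k] k} {v : V}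
    (hv : v ∈ wtSpace ((Algebra.lsmul k k V).comp D.inclH) μ) :
    D.sg γ 1 • v ∈ wtSpace ((Algebra.lsmul k k V).comp D.inclH) (D.act γ μ) := by
  intro h
  change D.inclH h • D.sg γ 1 • v = _
  rw [← mul_smul, inclH_mul_sg, mul_smul]
  have e : D.inclH (stableHom D.H D.smul_H γ⁻¹ h) • v = D.act γ μ h • v := hv _
  rw [e, smul_algebra_smul_comm]

/-- The `(H ⋊ Γ)`-submodule generated by a weight vector `v` is spanned by the vectors `γ v`. -/
theorem smul_mem_span_range_sg {V : Type*} [AddCommGroup V] [Module k V] [Module D.HΓ V]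
    [IsScalarTower k D.HΓ V] {μ : D.H →ₐ[k] k} {v : V}
    (hv : v ∈ wtSpace ((Algebra.lsmul k k V).comp D.inclH) μ) (s : D.HΓ) :
    s • v ∈ Submodule.span k (Set.range fun γ : Γ => D.sg γ 1 • v) := by
  induction s using D.HΓ_induction with
  | h0 => rw [zero_smul]; exact Submodule.zero_mem _
  | hadd s t hs ht => rw [add_smul]; exact Submodule.add_mem _ hs ht
  | hsg γ h =>
    rw [sg_eq, mul_smul]
    have e : D.inclH h • D.sg γ 1 • v = D.act γ μ h • D.sg γ 1 • v :=
      D.sg_smul_mem_wtSpace γ hv h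
    rw [e]
    exact Submodule.smul_mem _ _ (Submodule.subset_span ⟨γ, rfl⟩)

theorem center_smul_comm {M : Type*} [AddCommGroup M] [Module (SkewMonoidAlgebra A Γ) M]
    (z : Subalgebra.center k (SkewMonoidAlgebra A Γ))
    (r : SkewMonoidAlgebra A Γ) (m : M) :
    (z : SkewMonoidAlgebra A Γ) • r • m = r • (z : SkewMonoidAlgebra A Γ) • m := by
  rw [← mul_smul, ← mul_smul, Subalgebra.mem_center_iff.1 z.2 r]

section Modules

variable {M : Type u} [AddCommGroup M] [Module k M] [Module (SkewMonoidAlgebra A Γ) M]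
  [IsScalarTower k (SkewMonoidAlgebra A Γ) M]

theorem skewIncl_smul_mem_wtSpace {θ : D.P} {μ : D.H →ₐ[k] k} {a : A} (ha : a ∈ D.wt θ) {m : M}
    (hm : m ∈ wtSpace (D.rhoH M) μ) : skewIncl k A Γ a • m ∈ wtSpace (D.rhoH M) (θ • μ) := by
  -- The weight axiom concerns `A`-modules, so `M` is restricted along `A → A ⋊ Γ`.
  let _ : Module A M := Module.compHom M (skewIncl k A Γ).toRingHom
  have : IsScalarTower k A M := ⟨fun c a m => by
    change skewIncl k A Γ (c • a) • m = c • skewIncl k A Γ a • m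
    rw [map_smul, smul_assoc]⟩
  exact D.weights_smul M θ μ a ha m hm

theorem smul_comm_scalar (r : SkewMonoidAlgebra A Γ) (c : k) (m : M) : r • c • m = c • r • m :=
  smul_algebra_smul_comm c r m

theorem center_smul_mem_wtSpace (z : Subalgebra.center k (SkewMonoidAlgebra A Γ))
    {μ : D.H →ₐ[k] k} {m : M} (hm : m ∈ wtSpace (D.rhoH M) μ) :
    (z : SkewMonoidAlgebra A Γ) • m ∈ wtSpace (D.rhoH M) μ := by
  intro h
  change skewIncl k A Γ h • (z : SkewMonoidAlgebra A Γ) • m = _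
  have e : skewIncl k A Γ h • m = μ h • m := hm h
  rw [← center_smul_comm, e, smul_comm_scalar]

end Modules

/-! ### Verma modules -/

namespace X

variable {D} (x : D.X)

/-- The canonical map `M_x → Z(x)`. -/
def incl : x.V →ₗ[k] x.Verma :=
  (x.rel.mkQ.restrictScalars k) ∘ₗ (TensorProduct.mk k (SkewMonoidAlgebra A Γ) x.V 1)

theorem mk_tmul (r : SkewMonoidAlgebra A Γ) (v : x.V) :
    x.rel.mkQ (r ⊗ₜ[k] v) = r • x.incl v := by
  change _ = r • x.rel.mkQ (1 ⊗ₜ[k] v)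
  rw [← map_smul, TensorProduct.smul_tmul', smul_eq_mul, mul_one]

theorem incl_smul (s : D.HΓ) (v : x.V) :
    x.incl (s • v) = (s : SkewMonoidAlgebra A Γ) • x.incl v := by
  rw [← mk_tmul, eq_comm, ← sub_eq_zero]
  change x.rel.mkQ _ - x.rel.mkQ _ = 0
  rw [← map_sub]
  exact (Submodule.Quotient.mk_eq_zero _).2 (Submodule.subset_span (Or.inr ⟨s, v, rfl⟩))

theorem aug_smul_incl {n : A} (hn : n ∈ D.aug D.Bp) (v : x.V) :
    skewIncl k A Γ n • x.incl v = 0 := by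
  rw [← mk_tmul]
  exact (Submodule.Quotient.mk_eq_zero _).2 (Submodule.subset_span (Or.inl ⟨n, hn, v, rfl⟩))

@[elab_as_elim]
theorem verma_induction {p : x.Verma → Prop} (h0 : p 0) (hadd : ∀ a b, p a → p b → p (a + b))
    (hincl : ∀ (r : SkewMonoidAlgebra A Γ) (v : x.V), p (r • x.incl v)) (m : x.Verma) : p m := by
  obtain ⟨t, rfl⟩ := x.rel.mkQ_surjective m
  induction t using TensorProduct.induction_on with
  | zero => rw [map_zero]; exact h0
  | add a b ha hb => rw [map_add]; exact hadd _ _ ha hb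
  | tmul r v => rw [mk_tmul]; exact hincl r v

/-- At `r = 1` this is a retraction onto `M_x`: it makes `incl` injective and reads off central
scalars. -/
theorem exists_proj : ∃ ψ : x.Verma →ₗ[k] x.V,
    ∀ (r : SkewMonoidAlgebra A Γ) (v : x.V), ψ (r • x.incl v) = D.projHΓ r • v := by
  let φ : SkewMonoidAlgebra A Γ ⊗[k] x.V →ₗ[k] x.V :=
    TensorProduct.lift ((Algebra.lsmul k k x.V).toLinearMap ∘ₗ D.projHΓ)
  have hφ : ∀ r v, φ (r ⊗ₜ v) = D.projHΓ r • v := fun r v => TensorProduct.lift.tmul _ _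
  have hker : x.rel.restrictScalars k ≤ LinearMap.ker φ := by
    -- `φ` is only `k`-linear while `x.rel` is an `A ⋊ Γ`-span, so the induction must carry all left
    -- multiples.
    suffices ∀ t ∈ x.rel, ∀ r : SkewMonoidAlgebra A Γ, φ (r • t) = 0 by
      intro t ht
      have := this t ht 1
      rwa [one_smul] at this
    intro t ht
    induction ht using Submodule.span_induction with
    | mem t ht =>
      intro r
      rcases ht with ⟨n, hn, v, rfl⟩ | ⟨s, v, rfl⟩
      · rw [TensorProduct.smul_tmul', smul_eq_mul, hφ, D.projHΓ_mul_aug _ hn, zero_smul]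
      · rw [smul_sub, TensorProduct.smul_tmul', TensorProduct.smul_tmul', map_sub, hφ, hφ,
          smul_eq_mul, smul_eq_mul, mul_one, D.projHΓ_mul, mul_smul, sub_self]
    | zero => intro r; rw [smul_zero, map_zero]
    | add a b _ _ ha hb => intro r; rw [smul_add, map_add, ha, hb, add_zero]
    | smul c a _ ha => intro r; rw [← mul_smul]; exact ha _
  refine ⟨(x.rel.restrictScalars k).liftQ φ hker ∘ₗ
    (Submodule.Quotient.restrictScalarsEquiv k x.rel).symm.toLinearMap, fun r v => ?_⟩
  rw [← mk_tmul, ← hφ]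
  rfl

end X

end SkewRTA

namespace SkewRTA

variable {k A Γ : Type u} [Field k] [Ring A] [Algebra k A] [Group Γ]
  [MulSemiringAction Γ A] [SMulCommClass Γ k A] (D : SkewRTA k A Γ)

/-! ### `Γ`-orbits of weights -/

theorem res_act (γ : Γ) (μ : D.H →ₐ[k] k) :
    D.res (D.act γ μ) = wtAct D.H0 D.smul_H0 γ (D.res μ) := rfl

theorem wtAct_mul (γ γ' : Γ) (a : D.H0 →ₐ[k] k) :
    wtAct D.H0 D.smul_H0 (γ * γ') a = wtAct D.H0 D.smul_H0 γ (wtAct D.H0 D.smul_H0 γ' a) := by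
  ext h
  change a _ = a _
  congr 1
  apply Subtype.ext
  change (γ * γ')⁻¹ • (h : A) = γ'⁻¹ • γ⁻¹ • (h : A)
  rw [mul_inv_rev, mul_smul]

theorem wtAct_one (a : D.H0 →ₐ[k] k) : wtAct D.H0 D.smul_H0 (1 : Γ) a = a := by
  ext h
  change a _ = a _
  congr 1
  apply Subtype.ext
  change (1 : Γ)⁻¹ • (h : A) = h
  rw [inv_one, one_smul]

/-- An element of a `Γ`-orbit which is below another one is equal to it. -/
theorem le0_wtAct [Finite Γ] (γ : Γ) (a : D.H0 →ₐ[k] k)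
    (h : D.le0 (wtAct D.H0 D.smul_H0 γ a) a) : D.le0 a (wtAct D.H0 D.smul_H0 γ a) := by
  -- Applying powers of `γ` to `γ a ≤ a` gives a descending chain from `γ a`. At `n + 1 = orderOf γ`
  -- it has returned to `a`.
  have key : ∀ n : ℕ, D.le0 (wtAct D.H0 D.smul_H0 (γ ^ (n + 1)) a) (wtAct D.H0 D.smul_H0 γ a) := by
    intro n
    induction n with
    | zero =>
      rw [zero_add, pow_one]
      exact ⟨0, D.cone.zero_mem, zero_vadd _ _⟩
    | succ n ih =>
      refine D.le0_trans ?_ ih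
      rw [pow_succ, wtAct_mul]
      exact D.smul_le _ _ _ h
  have h1 := key (orderOf γ - 1)
  rwa [Nat.sub_add_cancel (orderOf_pos γ), pow_orderOf_eq_one, wtAct_one] at h1

/-- By `le0_wtAct` the restricted weights are comparable both ways. Freeness of `P₀` then puts both
`π(θ)` and `-π(θ)` in the pointed cone. -/
theorem piP_eq_zero_of_act [Finite Γ] (γ : Γ) (θ : D.P) (μ : D.H →ₐ[k] k)
    (hθ : -D.piP θ ∈ D.cone) (h : θ • μ = D.act γ μ) : D.piP θ = 0 := by
  have h0 : wtAct D.H0 D.smul_H0 γ (D.res μ) = D.piP θ +ᵥ D.res μ := by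
    rw [← res_act, ← h, D.res_smul]
  obtain ⟨c, hc, hca⟩ := D.le0_wtAct γ (D.res μ) ⟨-D.piP θ, hθ, by
    rw [h0, neg_vadd_vadd]⟩
  rw [h0] at hca
  have e : c = D.piP θ := D.vadd_left_injective (D.res μ) hca
  rw [e] at hc
  exact D.cone_pointed hc hθ (add_neg_cancel _)

/-! ### The top of a Verma module and its central character -/

namespace X

variable {D} (x : D.X)

instance : IsSimpleModule D.HΓ x.V := x.simple
instance : FiniteDimensional k x.V := x.finite
instance : Nontrivial x.V := IsSimpleModule.nontrivial D.HΓ x.V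

/-- The representation of `H` on `M_x`. -/
abbrev rho : D.H →ₐ[k] Module.End k x.V := (Algebra.lsmul k k x.V).comp D.inclH

theorem exists_smul_eq {v : x.V} (hv : v ≠ 0) (w : x.V) : ∃ s : D.HΓ, s • v = w :=
  IsSimpleModule.toSpanSingleton_surjective D.HΓ hv w

@[elab_as_elim]
theorem wt_induction {p : x.V → Prop} (h0 : p 0) (hadd : ∀ v w, p v → p w → p (v + w))
    (hwt : ∀ μ, ∀ v ∈ wtSpace x.rho μ, p v) (v : x.V) : p v := by
  have hv : v ∈ ⨆ μ, wtSpace x.rho μ := by rw [x.semisimple]; trivial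
  exact Submodule.iSup_induction _ (motive := p) hv hwt h0 hadd

theorem exists_wt : ∃ μ, ∃ v ∈ wtSpace x.rho μ, v ≠ 0 := by
  by_contra! hcon
  have : (⊤ : Submodule k x.V) = ⊥ := by
    rw [← x.semisimple, iSup_eq_bot]
    exact fun μ => (Submodule.eq_bot_iff _).2 (hcon μ)
  exact top_ne_bot this

/-- The set of weights of `M_x` is contained in a single `Γ`-orbit. -/
theorem exists_act_eq {μ μ' : D.H →ₐ[k] k} (hμ : μ ∈ x.wts) (hμ' : μ' ∈ x.wts) :
    ∃ γ : Γ, μ' = D.act γ μ := by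
  obtain ⟨v, hv, hv0⟩ := Submodule.exists_mem_ne_zero_of_ne_bot hμ
  obtain ⟨w, hw, hw0⟩ := Submodule.exists_mem_ne_zero_of_ne_bot hμ'
  obtain ⟨s, rfl⟩ := x.exists_smul_eq hv0 w
  by_contra! hcon
  -- By simplicity `w` lies in the span of the `γ v`, whose weights are the `γ μ`. Independence
  -- excludes any other weight.
  refine hw0 ((iSupIndep_wtSpace x.rho D.H_comm).eq_zero_of_mem
    (p := fun ν => ∃ γ : Γ, ν = D.act γ μ) hw (by push Not; exact hcon) ?_)
  refine (Submodule.span_le.2 ?_ :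
    Submodule.span k (Set.range fun γ : Γ => D.sg γ 1 • v) ≤ _) (D.smul_mem_span_range_sg hv s)
  rintro _ ⟨γ, rfl⟩
  exact Submodule.mem_iSup_of_mem _ (Submodule.mem_iSup_of_mem ⟨γ, rfl⟩
    (D.sg_smul_mem_wtSpace γ hv))

theorem act_mem_wts {μ : D.H →ₐ[k] k} (hμ : μ ∈ x.wts) (γ : Γ) : D.act γ μ ∈ x.wts := by
  obtain ⟨v, hv, hv0⟩ := Submodule.exists_mem_ne_zero_of_ne_bot hμ
  refine Submodule.ne_bot_iff _ |>.2 ⟨_, D.sg_smul_mem_wtSpace γ hv, fun h => hv0 ?_⟩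
  have : D.sg γ⁻¹ 1 • D.sg γ 1 • v = v := by
    rw [← mul_smul, D.sg_mul_sg, inv_mul_cancel, map_one, mul_one, ← D.inclH_eq_sg, map_one,
      one_smul]
  rw [← this, h, smul_zero]

theorem incl_mem_wtSpace {μ : D.H →ₐ[k] k} {v : x.V} (hv : v ∈ wtSpace x.rho μ) :
    x.incl v ∈ wtSpace (D.rhoH x.Verma) μ := by
  intro h
  change (D.inclH h : SkewMonoidAlgebra A Γ) • x.incl v = _
  have e : D.inclH h • v = μ h • v := hv h
  rw [← incl_smul, e, map_smul]

theorem exists_Bp_smul_incl {b : A} (hb : b ∈ D.Bp) (v : x.V) :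
    ∃ c : k, skewIncl k A Γ b • x.incl v = x.incl (c • v) := by
  obtain ⟨y, hy, n, hn, rfl⟩ := Submodule.mem_sup.1
    (D.le_span_sup_aug D.Bp {θ | D.piP θ ∈ D.cone} D.Bp_decomp D.Bp_zero hb)
  obtain ⟨c, rfl⟩ := Submodule.mem_span_singleton.1 hy
  exact ⟨c, by rw [map_add, add_smul, x.aug_smul_incl hn, add_zero, map_smul, map_one,
    smul_assoc, one_smul, map_smul]⟩

/-- Products of weight vectors of `B₋` and `M_x` with total weight `μ'`. -/
def vermaWt (μ' : D.H →ₐ[k] k) : Submodule k x.Verma :=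
  Submodule.span k {m | ∃ (θ : D.P) (μ : D.H →ₐ[k] k) (b : A) (v : x.V), -D.piP θ ∈ D.cone ∧
    b ∈ D.Bm ∧ b ∈ D.wt θ ∧ v ∈ wtSpace x.rho μ ∧ θ • μ = μ' ∧
    m = skewIncl k A Γ b • x.incl v}

/-- In `b h b' γ v` the factors `γ`, `b'` and `h` are absorbed into `M_x` in turn (`B₊` acts there
by scalars), leaving `B₋ M_x`. -/
theorem iSup_vermaWt : ⨆ μ, x.vermaWt μ = ⊤ := by
  have h1 : ∀ b ∈ D.Bm, ∀ v : x.V, skewIncl k A Γ b • x.incl v ∈ ⨆ μ, x.vermaWt μ := by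
    intro b hb v
    induction hb using D.Bm_induction with
    | h0 => rw [map_zero, zero_smul]; exact Submodule.zero_mem _
    | hadd a b _ _ ha hb => rw [map_add, add_smul]; exact Submodule.add_mem _ ha hb
    | hwt θ hθ b hbB hb =>
      induction v using x.wt_induction with
      | hwt μ v hv =>
        exact Submodule.mem_iSup_of_mem (θ • μ)
          (Submodule.subset_span ⟨θ, μ, b, v, hθ, hbB, hb, hv, rfl, rfl⟩)
      | h0 => rw [map_zero, smul_zero]; exact Submodule.zero_mem _
      | hadd v w hv hw => rw [map_add, smul_add]; exact Submodule.add_mem _ hv hw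
  have h2 : ∀ (a : A) (v : x.V), skewIncl k A Γ a • x.incl v ∈ ⨆ μ, x.vermaWt μ := by
    intro a v
    induction a using D.tri_induction with
    | h0 => rw [map_zero, zero_smul]; exact Submodule.zero_mem _
    | hadd a b ha hb => rw [map_add, add_smul]; exact Submodule.add_mem _ ha hb
    | hmul b h b' =>
      obtain ⟨c, hc⟩ := x.exists_Bp_smul_incl b'.2 v
      have e : skewIncl k A Γ h • x.incl (c • v) = x.incl (D.inclH h • c • v) :=
        (x.incl_smul (D.inclH h) _).symm
      rw [map_mul, map_mul, mul_smul, mul_smul, hc, e]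
      exact h1 b b.2 _
  rw [eq_top_iff]
  intro m _
  induction m using x.verma_induction with
  | h0 => exact Submodule.zero_mem _
  | hadd a b ha hb => exact Submodule.add_mem _ (ha trivial) (hb trivial)
  | hincl r v =>
    induction r using SkewMonoidAlgebra.induction_on with
    | zero => rw [zero_smul]; exact Submodule.zero_mem _
    | add r s hr hs => rw [add_smul]; exact Submodule.add_mem _ (hr trivial) (hs trivial)
    | single γ a =>
      have e : SkewMonoidAlgebra.single γ a =
          skewIncl k A Γ a * (D.sg γ 1 : SkewMonoidAlgebra A Γ) := by
        rw [skewIncl_apply, coe_sg, SkewMonoidAlgebra.single_mul_single]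
        simp
      rw [e, mul_smul, ← incl_smul]
      exact h2 a _

theorem vermaWt_eq (μ : D.H →ₐ[k] k) : x.vermaWt μ = wtSpace (D.rhoH x.Verma) μ := by
  refine (iSupIndep_wtSpace (D.rhoH x.Verma) D.H_comm).eq_of_le_of_iSup_eq_top (fun μ => ?_)
    x.iSup_vermaWt μ
  refine Submodule.span_le.2 ?_
  rintro _ ⟨θ, μ, b, v, -, -, hb, hv, rfl, rfl⟩
  exact D.skewIncl_smul_mem_wtSpace hb (x.incl_mem_wtSpace hv)

/-- The weight vectors of `Z(x)` whose weight is a weight of `M_x` belong to `M_x`. -/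
theorem mem_range_incl [Finite Γ] {μ : D.H →ₐ[k] k} (hμ : μ ∈ x.wts) {m : x.Verma}
    (hm : m ∈ wtSpace (D.rhoH x.Verma) μ) : m ∈ LinearMap.range x.incl := by
  rw [← x.vermaWt_eq] at hm
  refine (Submodule.span_le.2 ?_ : x.vermaWt μ ≤ _) hm
  rintro _ ⟨θ, μ', b, v, hθ, hbB, hb, hv, rfl, rfl⟩
  by_cases hv0 : v = 0
  · rw [hv0, map_zero, smul_zero]
    exact Submodule.zero_mem _
  · obtain ⟨γ, hγ⟩ := x.exists_act_eq (Submodule.ne_bot_iff _ |>.2 ⟨v, hv, hv0⟩) hμ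
    obtain ⟨c, rfl⟩ := Submodule.mem_span_singleton.1
      (D.mem_span_one_of_Bm hbB hb (D.piP_eq_zero_of_act γ θ μ' hθ hγ))
    exact ⟨c • v, by rw [map_smul, map_smul, map_one, smul_assoc, one_smul]⟩

/-- Schur's lemma for `M_x`. -/
theorem exists_scalar (hk : Nontrivial Γ → IsAlgClosed k) (f : x.V →ₗ[k] x.V)
    (hf : ∀ (s : D.HΓ) v, f (s • v) = s • f v) : ∃ c : k, ∀ v, f v = c • v := by
  -- One eigenvector suffices, since it generates the simple module.
  suffices ∃ c : k, ∃ v : x.V, v ≠ 0 ∧ f v = c • v by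
    obtain ⟨c, v, hv, hc⟩ := this
    refine ⟨c, fun w => ?_⟩
    obtain ⟨s, rfl⟩ := x.exists_smul_eq hv w
    rw [hf, hc, smul_algebra_smul_comm]
  -- For trivial `Γ` a weight vector already spans the module it generates, so an eigenvector exists
  -- over any field.
  rcases subsingleton_or_nontrivial Γ with hΓ | hΓ
  · obtain ⟨μ, v, hv, hv0⟩ := x.exists_wt
    obtain ⟨s, hs⟩ := x.exists_smul_eq hv0 (f v)
    have h1 := D.smul_mem_span_range_sg hv s
    have h2 : (Set.range fun γ : Γ => D.sg γ 1 • v) ⊆ {v} := by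
      rintro _ ⟨γ, rfl⟩
      change D.sg γ 1 • v = v
      rw [Subsingleton.elim γ 1, ← D.inclH_eq_sg, map_one, one_smul]
    obtain ⟨c, hc⟩ := Submodule.mem_span_singleton.1 (Submodule.span_mono h2 h1)
    exact ⟨c, v, hv0, by rw [hc, hs]⟩
  · have := hk hΓ
    obtain ⟨c, hc⟩ := Module.End.exists_eigenvalue f
    obtain ⟨v, hv⟩ := hc.exists_hasEigenvector
    exact ⟨c, v, hv.2, hv.apply_eq_smul⟩

theorem exists_center_scalar [Finite Γ] (hk : Nontrivial Γ → IsAlgClosed k)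
    (z : Subalgebra.center k (SkewMonoidAlgebra A Γ)) :
    ∃ c : k, ∀ m : x.Verma, (z : SkewMonoidAlgebra A Γ) • m = c • m := by
  obtain ⟨ψ, hψ⟩ := x.exists_proj
  have hψi : ∀ v, ψ (x.incl v) = v := fun v => by
    have := hψ 1 v
    rwa [one_smul, D.projHΓ_one, one_smul] at this
  have hmem : ∀ v, (z : SkewMonoidAlgebra A Γ) • x.incl v ∈ LinearMap.range x.incl := by
    intro v
    induction v using x.wt_induction with
    | hwt μ v hv =>
      by_cases hv0 : v = 0
      · rw [hv0, map_zero, smul_zero]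
        exact Submodule.zero_mem _
      · exact x.mem_range_incl (Submodule.ne_bot_iff _ |>.2 ⟨v, hv, hv0⟩)
          (D.center_smul_mem_wtSpace z (x.incl_mem_wtSpace hv))
    | h0 => rw [map_zero, smul_zero]; exact Submodule.zero_mem _
    | hadd v w hv hw => rw [map_add, smul_add]; exact Submodule.add_mem _ hv hw
  let f : x.V →ₗ[k] x.V := ψ ∘ₗ Algebra.lsmul k k x.Verma (z : SkewMonoidAlgebra A Γ) ∘ₗ x.incl
  have hf : ∀ v, x.incl (f v) = (z : SkewMonoidAlgebra A Γ) • x.incl v := by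
    intro v
    obtain ⟨w, hw⟩ := hmem v
    change x.incl (ψ ((z : SkewMonoidAlgebra A Γ) • x.incl v)) = _
    rw [← hw, hψi]
  have hinj : Function.Injective x.incl := Function.LeftInverse.injective hψi
  obtain ⟨c, hc⟩ := x.exists_scalar hk f fun s v => hinj <| by
    rw [hf, incl_smul, incl_smul, center_smul_comm, hf]
  refine ⟨c, fun m => ?_⟩
  induction m using x.verma_induction with
  | h0 => rw [smul_zero, smul_zero]
  | hadd a b ha hb => rw [smul_add, smul_add, ha, hb]
  | hincl r v => rw [center_smul_comm, ← hf, hc, map_smul, smul_comm_scalar]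

instance : Nontrivial x.Verma := by
  obtain ⟨ψ, hψ⟩ := x.exists_proj
  obtain ⟨v, hv⟩ := exists_ne (0 : x.V)
  refine ⟨⟨x.incl v, 0, fun h => hv ?_⟩⟩
  have := hψ 1 v
  rw [one_smul, D.projHΓ_one, one_smul] at this
  rw [← this, h, map_zero]

theorem ActsBy.unique {x : D.X} {χ χ' : Subalgebra.center k (SkewMonoidAlgebra A Γ) →ₐ[k] k}
    (h : x.ActsBy χ) (h' : x.ActsBy χ') : χ = χ' := by
  obtain ⟨m, hm⟩ := exists_ne (0 : x.Verma)
  ext z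
  exact smul_left_injective k hm ((h z m).symm.trans (h' z m))

theorem exists_actsBy [Finite Γ] (hk : Nontrivial Γ → IsAlgClosed k) :
    ∃ χ : Subalgebra.center k (SkewMonoidAlgebra A Γ) →ₐ[k] k, x.ActsBy χ := by
  choose c hc using x.exists_center_scalar hk
  -- The scalars form an algebra map because they can be compared on one nonzero vector.
  obtain ⟨m, hm⟩ := exists_ne (0 : x.Verma)
  have hinj := smul_left_injective k hm
  have hcomm : ∀ r : k, c (algebraMap k _ r) = r := fun r => hinj <| by
    change c _ • m = r • m
    rw [← hc]
    exact algebraMap_smul (SkewMonoidAlgebra A Γ) r m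
  refine ⟨{ toFun := c, map_one' := ?_, map_mul' := fun y z => hinj ?_, map_zero' := ?_,
            map_add' := fun y z => hinj ?_, commutes' := hcomm }, hc⟩
  · simpa using hcomm 1
  · change c _ • m = (c y * c z) • m
    rw [← hc, mul_smul, ← hc z, ← hc y, ← mul_smul]
    rfl
  · simpa using hcomm 0
  · change c _ • m = (c y + c z) • m
    rw [← hc, add_smul, ← hc z, ← hc y, ← add_smul]
    rfl

/-- The central character of `Z(x)` on `Z ∩ A` is given by the Harish-Chandra projection. -/
theorem ActsBy.eq_centralChar {x : D.X}
    {χ : Subalgebra.center k (SkewMonoidAlgebra A Γ) →ₐ[k] k} (h : x.ActsBy χ)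
    {μ : D.H →ₐ[k] k} (hμ : μ ∈ x.wts) (z : Subalgebra.center k (SkewMonoidAlgebra A Γ))
    (hz : (z : SkewMonoidAlgebra A Γ) ∈ (skewIncl k A Γ).range) :
    algebraMap k (MonoidAlgebra k Γ) (χ z) = D.centralChar μ z := by
  obtain ⟨a, ha⟩ := hz
  obtain ⟨v, hv, hv0⟩ := Submodule.exists_mem_ne_zero_of_ne_bot hμ
  obtain ⟨ψ, hψ⟩ := x.exists_proj
  have e1 : χ z = μ (D.hc a) := by
    refine smul_left_injective k hv0 ?_
    change χ z • v = μ (D.hc a) • v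
    have e2 := congrArg ψ (h z (x.incl v))
    have e3 := hψ 1 v
    rw [one_smul, D.projHΓ_one, one_smul] at e3
    rw [hψ, LinearMap.map_smul, e3, ← ha] at e2
    rw [← e2]
    change D.projHΓ (SkewMonoidAlgebra.single 1 a) • v = _
    rw [D.projHΓ_single]
    exact hv _
  have e4 : (z : SkewMonoidAlgebra A Γ) = SkewMonoidAlgebra.single 1 a := ha.symm
  rw [centralChar, e4, SkewMonoidAlgebra.sum_single_index, if_pos (D.act_one μ), e1]
  · rfl
  · simp

end X

end SkewRTA

/-! ### Transfer along injective maps -/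

theorem iSup_wtSpace_eq_top_of_injective {k H M N : Type*} [Field k] [Ring H] [Algebra k H]
    [AddCommGroup M] [Module k M] [AddCommGroup N] [Module k N]
    (ρ : H →ₐ[k] Module.End k M) (σ : H →ₐ[k] Module.End k N)
    (hcomm : ∀ a b : H, a * b = b * a) (htop : ⨆ μ, wtSpace ρ μ = ⊤) (i : N →ₗ[k] M)
    (hi : Function.Injective i) (hσ : ∀ h n, i (σ h n) = ρ h (i n)) :
    ⨆ μ, wtSpace σ μ = ⊤ := by
  have h1 := le_iSup_inf_wtSpace ρ hcomm htop (LinearMap.range i) (by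
    rintro h _ ⟨n, rfl⟩
    exact ⟨σ h n, hσ h n⟩)
  have h2 : ∀ μ, LinearMap.range i ⊓ wtSpace ρ μ ≤ (wtSpace σ μ).map i := by
    rintro μ _ ⟨⟨n, rfl⟩, hn⟩
    refine ⟨n, fun h => hi ?_, rfl⟩
    rw [hσ, hn h, map_smul]
  rw [eq_top_iff]
  intro n _
  have h3 := (h1.trans (iSup_mono h2)) ⟨n, rfl⟩
  rw [← Submodule.map_iSup] at h3
  obtain ⟨n', hn', he⟩ := h3
  rwa [hi he] at hn'

theorem finiteDimensional_of_map_le {k M N : Type*} [Field k] [AddCommGroup M] [Module k M]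
    [AddCommGroup N] [Module k N] (i : N →ₗ[k] M) (hi : Function.Injective i)
    (S : Submodule k N) (T : Submodule k M) [FiniteDimensional k T] (h : S.map i ≤ T) :
    FiniteDimensional k S :=
  FiniteDimensional.of_injective (i.restrict fun _ hx => h ⟨_, hx, rfl⟩)
    (fun _ _ h => Subtype.ext (hi (congrArg Subtype.val h)))

/-- An atom exists because finite dimension makes `W` Artinian. The result is an abstract module
with an embedding, ready to be packaged as an element of `X`. -/
theorem exists_isSimpleModule_of_finiteDimensional {k R M : Type u} [Field k] [Ring R]
    [Algebra k R] [AddCommGroup M] [Module k M] [Module R M] [IsScalarTower k R M]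
    (W : Submodule R M) (hW : W ≠ ⊥) (F : Submodule k M) [FiniteDimensional k F]
    (hWF : W.restrictScalars k ≤ F) :
    ∃ (V : Type u) (_ : AddCommGroup V) (_ : Module k V) (_ : Module R V)
      (_ : IsScalarTower k R V) (i : V →ₗ[R] M), Function.Injective i ∧ (∀ v, i v ∈ W) ∧
        IsSimpleModule R V ∧ FiniteDimensional k V := by
  have : FiniteDimensional k W := finiteDimensional_of_map_le
    LinearMap.id Function.injective_id (W.restrictScalars k) F (by rwa [Submodule.map_id])
  have : IsArtinian R W := isArtinian_of_tower k inferInstance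
  have : Nontrivial W := Submodule.nontrivial_iff_ne_bot.2 hW
  obtain ⟨S, hS⟩ : ∃ S : Submodule R W, IsAtom S := IsAtomic.exists_atom _
  exact ⟨S, inferInstance, inferInstance, inferInstance, inferInstance, W.subtype ∘ₗ S.subtype,
    W.subtype_injective.comp S.subtype_injective, fun v => (S.subtype v).2,
    isSimpleModule_iff_isAtom.2 hS,
    inferInstanceAs (FiniteDimensional k (S.restrictScalars k))⟩

namespace SkewRTA

variable {k A Γ : Type u} [Field k] [Ring A] [Algebra k A] [Group Γ]
  [MulSemiringAction Γ A] [SMulCommClass Γ k A] (D : SkewRTA k A Γ)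
  {M : Type u} [AddCommGroup M] [Module k M] [Module (SkewMonoidAlgebra A Γ) M]
  [IsScalarTower k (SkewMonoidAlgebra A Γ) M]

/-! ### Singular vectors -/

/-- A weight vector on which `B₊` acts locally finitely generates a singular weight vector. -/
theorem exists_singular_of_wt {μ : D.H →ₐ[k] k} {m : M} (hm : m ∈ wtSpace (D.rhoH M) μ)
    (hm0 : m ≠ 0)
    (hfin : FiniteDimensional k
      (Submodule.span k {m' : M | ∃ b ∈ D.Bp, m' = skewIncl k A Γ b • m})) :
    ∃ b : A, ∃ ν, skewIncl k A Γ b • m ∈ wtSpace (D.rhoH M) ν ∧ skewIncl k A Γ b • m ≠ 0 ∧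
      ∀ n ∈ D.aug D.Bp, skewIncl k A Γ n • skewIncl k A Γ b • m = 0 := by
  let S : Set D.P := {θ | D.piP θ ∈ D.cone ∧ ∃ b ∈ D.Bp, b ∈ D.wt θ ∧ skewIncl k A Γ b • m ≠ 0}
  -- For `θ` in `S` the chosen vectors `b_θ m` have distinct weights `θ • μ`, so they are linearly
  -- independent in the finite-dimensional space `B₊ m`.
  have hSfin : S.Finite := by
    choose! b hb hbθ hb0 using fun (θ : D.P) (h : θ ∈ S) => h.2
    let u : S → Submodule.span k {m' : M | ∃ b ∈ D.Bp, m' = skewIncl k A Γ b • m} := fun θ =>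
      ⟨skewIncl k A Γ (b θ) • m, Submodule.subset_span ⟨_, hb θ θ.2, rfl⟩⟩
    have hind : iSupIndep fun θ : S => wtSpace (D.rhoH M) (θ.1 • μ) :=
      (iSupIndep_wtSpace (D.rhoH M) D.H_comm).comp
        ((D.smul_left_injective μ).comp Subtype.val_injective)
    have hlin : LinearIndependent k u := by
      refine LinearIndependent.of_comp (Submodule.subtype _) ?_
      exact hind.linearIndependent _
        (fun θ => D.skewIncl_smul_mem_wtSpace (hbθ θ θ.2) hm) fun θ => hb0 θ θ.2
    have := hlin.finite
    exact Set.toFinite S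
  have hS1 : (1 : D.P) ∈ S := ⟨by rw [D.piP_one]; exact D.cone.zero_mem, 1, D.Bp.one_mem,
    D.H_le_wt_one D.H.one_mem, by rwa [map_one, one_smul]⟩
  -- Maximal height makes `b m` singular: a weight vector of `N₊` not killing it would strictly
  -- raise the height.
  obtain ⟨θ, ⟨hθ, b, hbB, hb, hb0⟩, hmax⟩ :=
    Set.exists_max_image S (fun θ => D.height (D.piP θ)) hSfin ⟨1, hS1⟩
  refine ⟨b, θ • μ, D.skewIncl_smul_mem_wtSpace hb hm, hb0, fun n hn => ?_⟩
  induction hn using D.aug_Bp_induction with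
  | h0 => rw [map_zero, zero_smul]
  | hadd x y _ _ hx hy => rw [map_add, add_smul, hx, hy, add_zero]
  | hwt θ' hθ' hθ0 n hnB hn _ =>
    by_contra hcon
    have hmem : θ' * θ ∈ S := by
      refine ⟨?_, n * b, D.Bp.mul_mem hnB hbB, D.mul_mem_wt hn hb, ?_⟩
      · rw [D.piP_mul]; exact D.cone.add_mem hθ' hθ
      · rwa [map_mul, mul_smul]
    have h1 := hmax _ hmem
    have h2 := D.height_pos hθ' hθ0
    rw [D.piP_mul, map_add] at h1
    omega

theorem skewIncl_mul_single (n : A) (γ : Γ) :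
    skewIncl k A Γ n * (SkewMonoidAlgebra.single γ 1 : SkewMonoidAlgebra A Γ) =
      SkewMonoidAlgebra.single γ 1 * skewIncl k A Γ (γ⁻¹ • n) := by
  rw [skewIncl_apply, skewIncl_apply, SkewMonoidAlgebra.single_mul_single,
    SkewMonoidAlgebra.single_mul_single]
  simp

/-- The universal property of Verma modules, with its consequence for the action of the center. -/
theorem X.ActsBy.smul_eq {D : SkewRTA k A Γ} {x : D.X}
    {χ : Subalgebra.center k (SkewMonoidAlgebra A Γ) →ₐ[k] k} (h : x.ActsBy χ)
    (j : x.V →ₗ[k] M) (hj : ∀ (s : D.HΓ) v, j (s • v) = (s : SkewMonoidAlgebra A Γ) • j v)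
    (haug : ∀ n ∈ D.aug D.Bp, ∀ v, skewIncl k A Γ n • j v = 0)
    (z : Subalgebra.center k (SkewMonoidAlgebra A Γ)) (v : x.V) :
    (z : SkewMonoidAlgebra A Γ) • j v = χ z • j v := by
  let φ : SkewMonoidAlgebra A Γ ⊗[k] x.V →ₗ[SkewMonoidAlgebra A Γ] M :=
    TensorProduct.AlgebraTensorModule.lift
      (LinearMap.toSpanSingleton (SkewMonoidAlgebra A Γ) (x.V →ₗ[k] M) j)
  have hφ : ∀ r v, φ (r ⊗ₜ v) = r • j v := fun r v => rfl
  have hker : x.rel ≤ LinearMap.ker φ := by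
    refine Submodule.span_le.2 ?_
    rintro t (⟨n, hn, v, rfl⟩ | ⟨s, v, rfl⟩)
    · exact haug n hn v
    · change φ _ = 0
      rw [map_sub, hφ, hφ, hj, one_smul, sub_self]
  have hincl : ∀ v, x.rel.liftQ φ hker (x.incl v) = j v := fun v => by
    change φ (1 ⊗ₜ v) = _
    rw [hφ, one_smul]
  have e := congrArg (x.rel.liftQ φ hker) (h z (x.incl v))
  rw [map_smul, hincl] at e
  rw [e, ← algebraMap_smul (SkewMonoidAlgebra A Γ) (χ z) (x.incl v), map_smul, hincl,
    algebraMap_smul]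

theorem exists_X_of_isSimpleModule {V : Type u} [AddCommGroup V] [Module k V] [Module D.HΓ V]
    [IsScalarTower k D.HΓ V] (hfin : FiniteDimensional k V)
    (hss : ⨆ μ : D.H →ₐ[k] k, wtSpace ((Algebra.lsmul k k V).comp D.inclH) μ = ⊤)
    (hsimple : IsSimpleModule D.HΓ V) (j : V →ₗ[k] M)
    (hj : ∀ (s : D.HΓ) v, j (s • v) = (s : SkewMonoidAlgebra A Γ) • j v)
    (haug : ∀ n ∈ D.aug D.Bp, ∀ v, skewIncl k A Γ n • j v = 0) :
    ∃ x : D.X, ∀ χ, x.ActsBy χ → ∀ (z : Subalgebra.center k (SkewMonoidAlgebra A Γ)) v,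
      (z : SkewMonoidAlgebra A Γ) • j v = χ z • j v :=
  ⟨{ V := V, finite := hfin, semisimple := hss, simple := hsimple },
    fun _ hχ z v => hχ.smul_eq j hj haug z v⟩

/-- A singular weight vector generates an `(H ⋊ Γ)`-module that contains some `M_x`. -/
theorem exists_X_of_singular [Finite Γ] (htop : ⨆ μ, wtSpace (D.rhoH M) μ = ⊤) {μ : D.H →ₐ[k] k} {v : M}
    (hv : v ∈ wtSpace (D.rhoH M) μ) (hv0 : v ≠ 0)
    (hsing : ∀ n ∈ D.aug D.Bp, skewIncl k A Γ n • v = 0) :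
    ∃ x : D.X, ∃ r : SkewMonoidAlgebra A Γ, r • v ≠ 0 ∧
      ∀ χ, x.ActsBy χ → ∀ z : Subalgebra.center k (SkewMonoidAlgebra A Γ),
        (z : SkewMonoidAlgebra A Γ) • r • v = χ z • r • v := by
  have : IsScalarTower k D.HΓ M :=
    ⟨fun c s m => smul_assoc c (s : SkewMonoidAlgebra A Γ) m⟩
  let W : Submodule D.HΓ M := Submodule.span D.HΓ {v}
  let F : Submodule k M := Submodule.span k (Set.range fun γ : Γ => D.sg γ 1 • v)
  have hF : FiniteDimensional k F := FiniteDimensional.span_of_finite k (Set.finite_range _)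
  have hWF : ∀ w ∈ W, w ∈ F := by
    intro w hw
    obtain ⟨s, rfl⟩ := Submodule.mem_span_singleton.1 hw
    exact D.smul_mem_span_range_sg hv s
  -- Since `n γ = γ (γ⁻¹ n)` and `N₊` is `Γ`-stable, all translates `γ v` are singular too.
  have haugF : ∀ w ∈ F, ∀ n ∈ D.aug D.Bp, skewIncl k A Γ n • w = 0 := by
    intro w hw n hn
    induction hw using Submodule.span_induction with
    | mem w hw =>
      obtain ⟨γ, rfl⟩ := hw
      change skewIncl k A Γ n • (SkewMonoidAlgebra.single γ 1 : SkewMonoidAlgebra A Γ) • v = 0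
      rw [← mul_smul, skewIncl_mul_single, mul_smul, hsing _ (D.smul_Np _ _ hn), smul_zero]
    | zero => rw [smul_zero]
    | add a b _ _ ha hb => rw [smul_add, ha, hb, add_zero]
    | smul c a _ ha => rw [smul_comm_scalar, ha, smul_zero]
  obtain ⟨V, _, _, _, _, i, hi, hiW, hsimple, hfin⟩ :=
    exists_isSimpleModule_of_finiteDimensional W
      (Submodule.ne_bot_iff _ |>.2 ⟨v, Submodule.mem_span_singleton_self v, hv0⟩) F hWF
  let j : V →ₗ[k] M := i.restrictScalars k
  have hj : ∀ (s : D.HΓ) u, j (s • u) = (s : SkewMonoidAlgebra A Γ) • j u := fun s u =>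
    i.map_smul s u
  have hss : ⨆ ν, wtSpace ((Algebra.lsmul k k V).comp D.inclH) ν = ⊤ :=
    iSup_wtSpace_eq_top_of_injective _ _ D.H_comm htop j hi fun h u => hj (D.inclH h) u
  obtain ⟨x, hx⟩ := D.exists_X_of_isSimpleModule hfin hss hsimple j hj
    (fun n hn u => haugF _ (hWF _ (hiW u)) n hn)
  have := IsSimpleModule.nontrivial D.HΓ V
  obtain ⟨w, hw⟩ := exists_ne (0 : V)
  obtain ⟨s, hs⟩ := Submodule.mem_span_singleton.1 (hiW w)
  have hjw : (s : SkewMonoidAlgebra A Γ) • v = j w := hs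
  refine ⟨x, s, ?_, fun χ hχ z => ?_⟩
  · rw [hjw]
    exact fun h => hw (hi (h.trans (map_zero i).symm))
  · rw [hjw]
    exact hx χ hχ z w

/-- Every nonzero submodule of a module in `𝒪` contains a nonzero vector on which the center acts
as on some Verma module. -/
theorem IsO.exists_center_eigenvector [Finite Γ] {D : SkewRTA k A Γ} (hM : D.IsO M)
    (N : Submodule (SkewMonoidAlgebra A Γ) M) (hN : N ≠ ⊥) :
    ∃ x : D.X, ∃ v ∈ N, v ≠ 0 ∧ ∀ χ, x.ActsBy χ →
      ∀ z : Subalgebra.center k (SkewMonoidAlgebra A Γ),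
        (z : SkewMonoidAlgebra A Γ) • v = χ z • v := by
  obtain ⟨μ, m, hm, hm0⟩ : ∃ μ, ∃ m ∈ N.restrictScalars k ⊓ wtSpace (D.rhoH M) μ, m ≠ 0 := by
    by_contra! hcon
    refine hN ((Submodule.eq_bot_iff _).2 fun m hm => ?_)
    have h1 := le_iSup_inf_wtSpace (D.rhoH M) D.H_comm hM.semisimple (N.restrictScalars k)
      (fun h m hm => N.smul_mem _ hm) hm
    rw [iSup_eq_bot.2 fun μ => (Submodule.eq_bot_iff _).2 (hcon μ)] at h1
    exact h1
  obtain ⟨b, ν, hb, hb0, hsing⟩ := D.exists_singular_of_wt hm.2 hm0 (hM.locally_finite m)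
  obtain ⟨x, r, hr, hx⟩ := D.exists_X_of_singular hM.semisimple hb hb0 hsing
  exact ⟨x, _, N.smul_mem r (N.smul_mem _ hm.1), hr, hx⟩

end SkewRTA

namespace SkewRTA

variable {k A Γ : Type u} [Field k] [Ring A] [Algebra k A] [Group Γ]
  [MulSemiringAction Γ A] [SMulCommClass Γ k A] (D : SkewRTA k A Γ)
  {M : Type u} [AddCommGroup M] [Module k M] [Module (SkewMonoidAlgebra A Γ) M]
  [IsScalarTower k (SkewMonoidAlgebra A Γ) M]

/-! ### Generalized central characters -/

/-- The action of the center of `A ⋊ Γ` on a module. -/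
abbrev centerEnd (M : Type u) [AddCommGroup M] [Module k M] [Module (SkewMonoidAlgebra A Γ) M]
    [IsScalarTower k (SkewMonoidAlgebra A Γ) M]
    (z : Subalgebra.center k (SkewMonoidAlgebra A Γ)) : Module.End k M :=
  Algebra.lsmul k k M (z : SkewMonoidAlgebra A Γ)

theorem centerEnd_commute (y z : Subalgebra.center k (SkewMonoidAlgebra A Γ)) :
    Commute (centerEnd M y) (centerEnd M z) :=
  LinearMap.ext fun m => center_smul_comm y (z : SkewMonoidAlgebra A Γ) m

theorem centerEnd_sub_pow_apply (z : Subalgebra.center k (SkewMonoidAlgebra A Γ)) (c : k) (n : ℕ)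
    (m : M) : ((centerEnd M z - c • (1 : Module.End k M)) ^ n) m =
      ((z : SkewMonoidAlgebra A Γ) - algebraMap k (SkewMonoidAlgebra A Γ) c) ^ n • m := by
  have e : centerEnd M z - c • (1 : Module.End k M) = Algebra.lsmul k k M
      ((z : SkewMonoidAlgebra A Γ) - algebraMap k (SkewMonoidAlgebra A Γ) c) := by
    rw [map_sub, AlgHom.commutes, Algebra.algebraMap_eq_smul_one]
  rw [e, ← map_pow]
  rfl

/-- The submodule on which all `z - χ(z)`, for `z` in the center, are locally nilpotent. -/
def genCenter (M : Type u) [AddCommGroup M] [Module k M] [Module (SkewMonoidAlgebra A Γ) M]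
    [IsScalarTower k (SkewMonoidAlgebra A Γ) M]
    (χ : Subalgebra.center k (SkewMonoidAlgebra A Γ) → k) :
    Submodule (SkewMonoidAlgebra A Γ) M where
  __ := ⨅ z, (centerEnd M z).maxGenEigenspace (χ z)
  smul_mem' := by
    intro r m hm
    change r • m ∈ ⨅ z, (centerEnd M z).maxGenEigenspace (χ z)
    replace hm : m ∈ ⨅ z, (centerEnd M z).maxGenEigenspace (χ z) := hm
    rw [Module.End.mem_iInf_maxGenEigenspace_iff] at hm ⊢
    intro z
    obtain ⟨n, hn⟩ := hm z
    refine ⟨n, ?_⟩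
    rw [centerEnd_sub_pow_apply] at hn ⊢
    let y : Subalgebra.center k (SkewMonoidAlgebra A Γ) := (z - algebraMap k _ (χ z)) ^ n
    change (y : SkewMonoidAlgebra A Γ) • r • m = 0
    rw [center_smul_comm]
    exact (congrArg (r • ·) hn).trans (smul_zero r)

theorem mem_genCenter {χ : Subalgebra.center k (SkewMonoidAlgebra A Γ) → k} {m : M} :
    m ∈ genCenter M χ ↔ ∀ z : Subalgebra.center k (SkewMonoidAlgebra A Γ), ∃ n : ℕ,
      ((z : SkewMonoidAlgebra A Γ) - algebraMap k (SkewMonoidAlgebra A Γ) (χ z)) ^ n • m = 0 := by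
  have h : m ∈ genCenter M χ ↔ m ∈ ⨅ z, (centerEnd M z).maxGenEigenspace (χ z) := Iff.rfl
  rw [h, Module.End.mem_iInf_maxGenEigenspace_iff]
  exact forall_congr' fun z => exists_congr fun n => by rw [centerEnd_sub_pow_apply]

/-- Indices are arbitrary functions `Z → k`. That the relevant ones are algebra maps is recovered
later from Verma modules. -/
theorem iSupIndep_genCenter :
    iSupIndep fun χ : Subalgebra.center k (SkewMonoidAlgebra A Γ) → k => genCenter M χ := by
  have h := Module.End.independent_iInf_maxGenEigenspace_of_forall_mapsTo
    (fun z : Subalgebra.center k (SkewMonoidAlgebra A Γ) => centerEnd M z)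
    fun y z φ => Module.End.mapsTo_maxGenEigenspace_of_comm (centerEnd_commute z y) φ
  intro χ
  rw [Submodule.disjoint_def]
  intro m hm hm'
  refine Submodule.disjoint_def.1 (h χ) m hm ?_
  have hm2 : m ∈ (⨆ (χ') (_ : χ' ≠ χ), genCenter M χ').restrictScalars k := hm'
  simp only [Submodule.restrictScalars_iSup] at hm2
  exact hm2

theorem eq_of_sub_pow_smul_eq_zero {z : Subalgebra.center k (SkewMonoidAlgebra A Γ)} {c d : k}
    {m : M} (hm : m ≠ 0) {n n' : ℕ}
    (h : ((z : SkewMonoidAlgebra A Γ) - algebraMap k (SkewMonoidAlgebra A Γ) c) ^ n • m = 0)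
    (h' : ((z : SkewMonoidAlgebra A Γ) - algebraMap k (SkewMonoidAlgebra A Γ) d) ^ n' • m = 0) :
    c = d := by
  by_contra hcd
  refine hm (Submodule.disjoint_def.1
    (Module.End.disjoint_genEigenspace (centerEnd M z) hcd ⊤ ⊤) m ?_ ?_)
  · exact Module.End.mem_maxGenEigenspace _ _ _ |>.2 ⟨n, by rw [centerEnd_sub_pow_apply, h]⟩
  · exact Module.End.mem_maxGenEigenspace _ _ _ |>.2 ⟨n', by rw [centerEnd_sub_pow_apply, h']⟩

theorem sub_pow_one_smul_eq_zero {z : Subalgebra.center k (SkewMonoidAlgebra A Γ)} {c : k}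
    {m : M} (h : (z : SkewMonoidAlgebra A Γ) • m = c • m) :
    ((z : SkewMonoidAlgebra A Γ) - algebraMap k (SkewMonoidAlgebra A Γ) c) ^ 1 • m = 0 := by
  rw [pow_one, sub_smul, h, algebraMap_smul, sub_self]

/-! ### Spectrum of the center on modules in `𝒪` -/

namespace IsO

variable {D}

/-- The characters with nonzero generalized eigenspaces in a module in `𝒪` come from Verma
modules. -/
theorem exists_eq_of_genCenter_ne_bot [Finite Γ] (hM : D.IsO M)
    (hθ : ∀ x : D.X, ∃ θ : Subalgebra.center k (SkewMonoidAlgebra A Γ) →ₐ[k] k, x.ActsBy θ)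
    {χ : Subalgebra.center k (SkewMonoidAlgebra A Γ) → k} (hχ : genCenter M χ ≠ ⊥) :
    ∃ ν ∈ D.Theta, χ = ν := by
  obtain ⟨x, v, hv, hv0, hx⟩ := hM.exists_center_eigenvector _ hχ
  obtain ⟨θ, h⟩ := hθ x
  refine ⟨θ, ⟨x, h⟩, funext fun z => ?_⟩
  obtain ⟨n, hn⟩ := mem_genCenter.1 hv z
  exact eq_of_sub_pow_smul_eq_zero hv0 hn (sub_pow_one_smul_eq_zero (hx θ h z))

/-- If an irreducible polynomial in a central element kills a nonzero vector of a module in `𝒪`,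
then it has a root. -/
theorem exists_isRoot [Finite Γ] (hM : D.IsO M)
    (hθ : ∀ x : D.X, ∃ θ : Subalgebra.center k (SkewMonoidAlgebra A Γ) →ₐ[k] k, x.ActsBy θ)
    (z : Subalgebra.center k (SkewMonoidAlgebra A Γ)) (q : Polynomial k) {m : M} (hm : m ≠ 0)
    (hq : (Polynomial.aeval z q : SkewMonoidAlgebra A Γ) • m = 0) : ∃ c, q.IsRoot c := by
  -- The kernel of the central element `q(z)` is a submodule, so it contains an eigenvector with
  -- some eigenvalue `θ(z)` in `k`, and then `q(θ(z)) = 0`.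
  let N : Submodule (SkewMonoidAlgebra A Γ) M :=
    { carrier := {m | (Polynomial.aeval z q : SkewMonoidAlgebra A Γ) • m = 0}
      zero_mem' := smul_zero _
      add_mem' := fun {a b} ha hb => by
        rw [Set.mem_ofPred_eq] at *
        rw [smul_add, ha, hb, add_zero]
      smul_mem' := fun r a ha => by
        rw [Set.mem_ofPred_eq] at *
        rw [center_smul_comm, ha, smul_zero] }
  obtain ⟨x, v, hv, hv0, hx⟩ := hM.exists_center_eigenvector N
    (Submodule.ne_bot_iff _ |>.2 ⟨m, hq, hm⟩)
  obtain ⟨θ, h⟩ := hθ x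
  refine ⟨θ z, ?_⟩
  have e : (Polynomial.aeval z q : SkewMonoidAlgebra A Γ) • v = θ (Polynomial.aeval z q) • v :=
    hx θ h _
  have e0 : (Polynomial.aeval z q : SkewMonoidAlgebra A Γ) • v = 0 := hv
  rw [e0, ← Polynomial.aeval_algHom_apply, Polynomial.coe_aeval_eq_eval, eq_comm,
    smul_eq_zero] at e
  exact e.resolve_right hv0

/-- Weight spaces are finite-dimensional and stable under the center. On each one, the commuting
central operators have all needed eigenvalues in `k` by `exists_isRoot`, hence a joint generalized
eigenspace decomposition. -/
theorem iSup_genCenter [Finite Γ] (hM : D.IsO M)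
    (hθ : ∀ x : D.X, ∃ θ : Subalgebra.center k (SkewMonoidAlgebra A Γ) →ₐ[k] k, x.ActsBy θ) :
    ⨆ χ : Subalgebra.center k (SkewMonoidAlgebra A Γ) → k, genCenter M χ = ⊤ := by
  suffices h : (⨆ χ : Subalgebra.center k (SkewMonoidAlgebra A Γ) → k,
      genCenter M χ).restrictScalars k = ⊤ by
    rw [eq_top_iff]
    intro m _
    have : m ∈ (⊤ : Submodule k M) := trivial
    rwa [← h] at this
  rw [eq_top_iff, ← hM.semisimple, Submodule.restrictScalars_iSup]
  refine iSup_le fun μ => ?_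
  have := hM.finite_wt μ
  let p := wtSpace (D.rhoH M) μ
  have hp : ∀ z, Set.MapsTo (centerEnd M z) p p := fun z m hm => D.center_smul_mem_wtSpace z hm
  let f : Subalgebra.center k (SkewMonoidAlgebra A Γ) → Module.End k p := fun z =>
    (centerEnd M z).restrict (hp z)
  have haeval : ∀ z (q : Polynomial k) (v : p), ((Polynomial.aeval (f z) q v : p) : M) =
      (Polynomial.aeval z q : SkewMonoidAlgebra A Γ) • (v : M) := by
    intro z q v
    induction q using Polynomial.induction_on' generalizing v with
    | add q r hq hr =>
      rw [map_add, LinearMap.add_apply, Submodule.coe_add, hq, hr, map_add, Subalgebra.coe_add,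
        add_smul]
    | monomial n a =>
      rw [Polynomial.aeval_monomial, Polynomial.aeval_monomial, Module.End.mul_apply,
        Module.algebraMap_end_apply, Submodule.coe_smul, Subalgebra.coe_mul, mul_smul]
      have h1 : ∀ n (v : p), (((f z ^ n) v : p) : M) =
          ((z ^ n : Subalgebra.center k (SkewMonoidAlgebra A Γ)) :
            SkewMonoidAlgebra A Γ) • (v : M) := by
        intro n
        induction n with
        | zero => intro v; rw [pow_zero, pow_zero, Subalgebra.coe_one, one_smul]; rfl
        | succ n ih =>
          intro v
          rw [pow_succ, pow_succ, Module.End.mul_apply, ih, Subalgebra.coe_mul, mul_smul]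
          rfl
      rw [h1]
      exact (algebraMap_smul (SkewMonoidAlgebra A Γ) a _).symm
  have key := Module.End.iSup_iInf_maxGenEigenspace_eq_top_of_iSup_maxGenEigenspace_eq_top_of_commute
    f (fun y z _ => LinearMap.ext fun m =>
      Subtype.ext (center_smul_comm y (z : SkewMonoidAlgebra A Γ) (m : M)))
    (fun z => iSup_maxGenEigenspace_eq_top_of_forall_irreducible (f z) fun q _ ⟨v, hv0, hv⟩ =>
      hM.exists_isRoot hθ z q (m := (v : M)) (fun h => hv0 (Subtype.ext h)) (by
        rw [← haeval, hv]; rfl))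
  have h2 := congrArg (Submodule.map p.subtype) key
  rw [Submodule.map_iSup, Submodule.map_top, Submodule.range_subtype] at h2
  change p ≤ _
  rw [← h2]
  refine iSup_mono fun χ => ?_
  rw [← Submodule.inf_iInf_maxGenEigenspace_of_forall_mapsTo (centerEnd M) p hp]
  exact inf_le_right

/-- The complement serves finite generation: `N` becomes a quotient of `M`. The other conditions
pass to any submodule. -/
theorem submodule (hM : D.IsO M) (N : Submodule (SkewMonoidAlgebra A Γ) M)
    (hN : ∃ N', IsCompl N N') : D.IsO N := by
  let i : N →ₗ[k] M := N.subtype.restrictScalars k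
  have hi : Function.Injective i := N.subtype_injective
  refine ⟨?_, ?_, fun μ => ?_, fun m => ?_⟩
  · obtain ⟨N', hN'⟩ := hN
    have := hM.fg
    exact Module.Finite.of_surjective (N.projectionOnto N' hN')
      (Submodule.projectionOnto_surjective hN')
  · exact iSup_wtSpace_eq_top_of_injective (D.rhoH M) _ D.H_comm hM.semisimple i hi
      fun _ _ => rfl
  · have := hM.finite_wt μ
    refine finiteDimensional_of_map_le i hi _ (wtSpace (D.rhoH M) μ) ?_
    rintro _ ⟨n, hn, rfl⟩ h
    exact congrArg i (hn h)
  · have := hM.locally_finite m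
    refine finiteDimensional_of_map_le i hi _ (Submodule.span k
      {m' : M | ∃ b ∈ D.Bp, m' = skewIncl k A Γ b • (m : M)}) ?_
    rw [Submodule.map_span, Submodule.span_le]
    rintro _ ⟨_, ⟨b, hb, rfl⟩, rfl⟩
    exact Submodule.subset_span ⟨b, hb, rfl⟩

end IsO

/-! ### The block decomposition of `𝒪` -/

theorem isDirectSumO_Theta [Finite Γ]
    (hθ : ∀ x : D.X, ∃ θ : Subalgebra.center k (SkewMonoidAlgebra A Γ) →ₐ[k] k, x.ActsBy θ) :
    D.IsDirectSumO D.Theta where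
  decomp M _ _ _ _ hM := by
    let N : D.Theta → Submodule (SkewMonoidAlgebra A Γ) M := fun ν => genCenter M ν.1
    have hind : iSupIndep N := iSupIndep_genCenter.comp (fun ν ν' h =>
      Subtype.ext (DFunLike.coe_injective h) :
        Function.Injective fun (ν : D.Theta) (z : Subalgebra.center k _) => ν.1 z)
    have htop : ⨆ ν, N ν = ⊤ := by
      rw [eq_top_iff, ← hM.iSup_genCenter hθ]
      refine iSup_le fun χ => ?_
      by_cases hχ : genCenter M χ = ⊥
      · rw [hχ]; exact bot_le
      · obtain ⟨ν, hν, rfl⟩ := hM.exists_eq_of_genCenter_ne_bot hθ hχ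
        exact le_iSup N ⟨ν, hν⟩
    have hcompl : ∀ ν, IsCompl (N ν) (⨆ (ν') (_ : ν' ≠ ν), N ν') := by
      refine fun ν => ⟨hind ν, codisjoint_iff.2 ?_⟩
      rw [eq_top_iff, ← htop]
      refine iSup_le fun ν' => ?_
      by_cases h : ν' = ν
      · subst h; exact le_sup_left
      · exact le_sup_of_le_right (le_iSup₂_of_le ν' h le_rfl)
    refine ⟨N, fun ν => ⟨hM.submodule _ ⟨_, hcompl ν⟩, fun m z => ?_⟩, hind, htop, ?_⟩
    · obtain ⟨n, hn⟩ := mem_genCenter.1 m.2 z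
      exact ⟨n, Subtype.ext hn⟩
    · have := hM.fg
      -- A finitely generated module is a compact element of its submodule lattice, so finitely many
      -- blocks already fill `M`. By independence every other block is zero.
      obtain ⟨s, hs⟩ := CompleteLattice.IsCompactElement.exists_finset_of_le_iSup _
        ((Submodule.fg_iff_compact (⊤ : Submodule (SkewMonoidAlgebra A Γ) M)).1
          Module.Finite.fg_top) N htop.ge
      refine s.finite_toSet.subset fun ν hν => ?_
      by_contra hνs
      refine hν (disjoint_self.1 ((hind ν).mono_right (le_top.trans (hs.trans ?_))))
      exact iSup₂_le fun ν' hν' =>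
        le_iSup₂_of_le (f := fun ν' (_ : ν' ≠ ν) => N ν') ν' (fun h => hνs (h ▸ hν')) le_rfl
  hom_eq_zero ν ν' hne M M' _ _ _ _ _ _ _ _ hM hM' f := by
    ext m
    by_contra hm
    -- If `f m ≠ 0`, it is a generalized eigenvector of each `z` for both `ν(z)` and `ν'(z)`, so
    -- these agree.
    refine hne (Subtype.ext (AlgHom.ext fun z => ?_))
    obtain ⟨n, hn⟩ := hM.nilpotent m z
    obtain ⟨n', hn'⟩ := hM'.nilpotent (f m) z
    have hn2 : ((z : SkewMonoidAlgebra A Γ) - algebraMap k (SkewMonoidAlgebra A Γ) (ν.1 z)) ^ n •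
        f m = 0 := by rw [← map_smul, hn, map_zero]
    exact eq_of_sub_pow_smul_eq_zero hm hn2 hn'

end SkewRTA

end

theorem theorem9 {k A Γ : Type u} [Field k] [Ring A] [Algebra k A] [Group Γ] [Finite Γ]
    [MulSemiringAction Γ A] [SMulCommClass Γ k A] (D : SkewRTA k A Γ)
    (hchar : Nontrivial Γ → CharZero k) :
    ((Nontrivial Γ → IsAlgClosed k) →
      ∀ x : D.X,
        (∃! χ : Subalgebra.center k (SkewMonoidAlgebra A Γ) →ₐ[k] k, x.ActsBy χ) ∧
        ∀ χ : Subalgebra.center k (SkewMonoidAlgebra A Γ) →ₐ[k] k, x.ActsBy χ →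
          ∀ μ ∈ x.wts, ∀ γ : Γ,
            ∀ z : Subalgebra.center k (SkewMonoidAlgebra A Γ),
              (z : SkewMonoidAlgebra A Γ) ∈ (skewIncl k A Γ).range →
              algebraMap k (MonoidAlgebra k Γ) (χ z) = D.centralChar μ z ∧
              algebraMap k (MonoidAlgebra k Γ) (χ z) = D.centralChar (D.act γ μ) z) ∧
    ((∀ x : D.X, ∃ θ : Subalgebra.center k (SkewMonoidAlgebra A Γ) →ₐ[k] k, x.ActsBy θ) →
      D.IsDirectSumO D.Theta) := by
  refine ⟨fun hk x => ⟨?_, fun χ hχ μ hμ γ z hz => ⟨hχ.eq_centralChar hμ z hz,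
    hχ.eq_centralChar (x.act_mem_wts hμ γ) z hz⟩⟩, D.isDirectSumO_Theta⟩
  obtain ⟨χ, hχ⟩ := x.exists_actsBy hk
  exact ⟨χ, hχ, fun χ' hχ' => hχ'.unique hχ⟩
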